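/- **Conventions.** A *regular category* is a category with finite limits in which every kernel pair has a coequalizer and regular epimorphisms are stable under pullback; a *regular functor* preserves finite limits and regular epimorphisms. For a regular category $\mathcal C$, a relation $r\nrightarrow s$ is a subobject of $r\times s$; relations are composed by pullback followed by image, are ordered as subobjects, and form a symmetric monoidal po-category $\mathbb{R}\mathrm{el}_{\mathcal C}$ under $\times$. The graph of $f:r\to s$ is $\langle \mathrm{id},f\rangle\subseteq r\times s$. An *ajax po-functor* $P:\mathbb{R}\mathrm{el}_{\mathcal C}\to\mathbb{P}\mathrm{oset}$ is a lax symmetric monoidal po-functor whose laxators $1\to P(1)$ and $\rho: P(X)\times P(Y)\to P(X\times Y)$ are right adjoints. For a morphism $f$ write $f_!$ for $P$ of the graph of $f$. For a set $T$, the free regular category $\mathrm{FRg}(T)$ has as objects the contexts $\Gamma=(n,S,\tau)$ with $n\in\mathbb N$, $S\subseteq T$ finite and $\tau:\{1,\dots,n\}\to S$; a morphism $(n,S,\tau)\to(n',S',\tau')$ is a function $f:\{1,\dots,n'\}\to\{1,\dots,n\}$ with $\tau\circ f=\tau'$, and it exists only if $S'\subseteq S$. A function $F:T\to T'$ induces a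 regular functor $\mathrm{FRg}(F)$, $(n,S,\tau)\mapsto(n,F(S),F\circ\tau)$. For a regular category $\mathcal R$ let $\ulcorner-\urcorner:\mathrm{FRg}(\mathrm{Ob}\,\mathcal R)\to\mathcal R$ be the regular functor $\ulcorner\Gamma\urcorner=\prod_{i}\tau(i)\times\prod_{s\in S}\mathrm{Supp}(s)$, where $\mathrm{Supp}(s)$ is the image of $s\to 1$, acting on morphisms by projections and diagonals. A *regular calculus* is a set $T$ with an ajax po-functor $P:\mathbb{R}\mathrm{el}_{\mathrm{FRg}(T)}\to\mathbb{P}\mathrm{oset}$. A morphism $(T,P)\to(T',P')$ is a function $F:T\to T'$ with a strict monoidal natural transformation $F^\sharp:P\to P'\circ\mathrm{FRg}(F)$. For a regular category $\mathcal R$ put $\mathrm{prd}(\mathcal R)=(\mathrm{Ob}\,\mathcal R,\ \mathrm{Sub}_{\mathcal R}\ulcorner-\urcorner)$, where a relation acts on subobjects by pullback followed by image, and the laxators are given by $\top$ and by products of subobjects. A regular functor $\mathcal F:\mathcal R\to\mathcal R'$ gives $\mathrm{prd}(\mathcal F)=(\mathrm{Ob}\,\mathcal F,\ \mathrm{Sub}_{\mathcal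 F})$, where $\mathrm{Sub}_{\mathcal F}$ applies $\mathcal F$ to a subobject of $\ulcorner\Gamma\urcorner$ and transports it along the canonical isomorphism $\kappa_\Gamma:\mathcal F\ulcorner\Gamma\urcorner\cong\ulcorner\mathrm{FRg}(\mathrm{Ob}\,\mathcal F)(\Gamma)\urcorner$. The po-category $\mathbb{I}\mathrm{ntRel}_P$ of internal relations has as objects the pairs $(\Gamma,\varphi)$ with $\varphi\in P(\Gamma)$; its hom-poset from $(\Gamma_1,\varphi_1)$ to $(\Gamma_2,\varphi_2)$ is $\{\theta\in P(\Gamma_1\times\Gamma_2)\mid (\pi_1)_!\theta\le\varphi_1,\ (\pi_2)_!\theta\le\varphi_2\}$. The identity of $(\Gamma,\varphi)$ is $\delta_!\varphi$, where $\delta$ is the diagonal of $\Gamma$, and the composite of $\theta_{12}$ and $\theta_{23}$ is $P(c)(\rho(\theta_{12},\theta_{23}))$, where $c:(\Gamma_1\times\Gamma_2)\times(\Gamma_2\times\Gamma_3)\nrightarrow\Gamma_1\times\Gamma_3$ is the relation given by the span $(\Gamma_1\times\Gamma_2)\times(\Gamma_2\times\Gamma_3)\leftarrow\Gamma_1\times\Gamma_2\times\Gamma_3\to\Gamma_1\times\Gamma_3$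 (diagonal on $\Gamma_2$; projection). The *syntactic category* $\mathrm{syn}(T,P)$ has the same objects, and its morphisms are the left adjoints in $\mathbb{I}\mathrm{ntRel}_P$. A morphism $(F,F^\sharp)$ of regular calculi induces the functor $\mathrm{syn}(F,F^\sharp)$ with $(\Gamma,\varphi)\mapsto(\mathrm{FRg}(F)(\Gamma),F^\sharp\varphi)$ and $\theta\mapsto F^\sharp\theta$, up to the canonical isomorphism $\mathrm{FRg}(F)(\Gamma_1\times\Gamma_2)\cong\mathrm{FRg}(F)(\Gamma_1)\times\mathrm{FRg}(F)(\Gamma_2)$. **Proposition 8.3.** For every regular category $\mathcal R$ there is an equivalence of categories $$\epsilon_{\mathcal R}:\mathrm{syn}(\mathrm{prd}(\mathcal R))\xrightarrow{\ \simeq\ }\mathcal R,$$ natural in $\mathcal R$. More precisely: 1. On objects, $\epsilon_{\mathcal R}(\Gamma,r)=r$, the object of $\mathcal R$ underlying the subobject $r\subseteq\ulcorner\Gamma\urcorner$. 2. Restricting a subobject of $\ulcorner\Gamma_1\times\Gamma_2\urcorner\cong\ulcorner\Gamma_1\urcorner\times\ulcorner\Gamma_2\urcorner$ along $r_1\times r_2\to\ulcorner\Gamma_1\urcorner\times\ulcorner\Gamma_2\urcorner$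 gives isomorphisms of posets $\mathbb{I}\mathrm{ntRel}_{\mathrm{prd}(\mathcal R)}((\Gamma_1,r_1),(\Gamma_2,r_2))\cong\mathbb{R}\mathrm{el}_{\mathcal R}(r_1,r_2)$, which are compatible with identities and composition. 3. For every morphism $\theta:(\Gamma_1,r_1)\to(\Gamma_2,r_2)$ of $\mathrm{syn}(\mathrm{prd}(\mathcal R))$, the relation that corresponds to $\theta$ under 2 is the graph of $\epsilon_{\mathcal R}(\theta):r_1\to r_2$. 4. For every regular functor $\mathcal F:\mathcal R\to\mathcal R'$ there is a natural isomorphism $\alpha:\epsilon_{\mathcal R'}\circ\mathrm{syn}(\mathrm{prd}(\mathcal F))\cong\mathcal F\circ\epsilon_{\mathcal R}$ whose component at $(\Gamma,r)$ is the canonical isomorphism between the object underlying the subobject $\mathrm{Sub}_{\mathcal F}(r)$ and $\mathcal F(r)$, i.e. it is compatible with the monomorphism $\mathrm{Sub}_{\mathcal F}(r)\to\ulcorner\mathrm{FRg}(\mathrm{Ob}\,\mathcal F)(\Gamma)\urcorner$ and the monomorphism $\mathcal F(r)\to\mathcal F\ulcorner\Gamma\urcorner\cong\ulcorner\mathrm{FRg}(\mathrm{Ob}\,\mathcal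 F)(\Gamma)\urcorner$ given by $\mathcal F(r\subseteq\ulcorner\Gamma\urcorner)$ and $\kappa_\Gamma$. -/

import Mathlib

open CategoryTheory CategoryTheory.Limits
universe u v u' v' w w' w''
set_option linter.unusedSectionVars false
namespace GraphicalRegularLogic

attribute [local simp] prod.lift_fst prod.lift_snd prod.lift_fst_assoc prod.lift_snd_assoc
  pullback.lift_fst pullback.lift_snd pullback.lift_fst_assoc pullback.lift_snd_assoc

section Covers

variable {C : Type u} [Category.{v} C] [Regular C]

theorem isRegularEpi_of_strongEpi {X Y : C} (f : X ⟶ Y) [StrongEpi f] : IsRegularEpi f := by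
  infer_instance

theorem strongEpi_pullback_fst {X Y Z : C} (f : X ⟶ Z) (g : Y ⟶ Z) [StrongEpi g] :
    StrongEpi (pullback.fst f g) := by
  have : IsRegularEpi g := isRegularEpi_of_strongEpi g
  infer_instance

theorem factors_of_cover {A B X : C} (x : Subobject X) (e : A ⟶ B) [StrongEpi e] (f : B ⟶ X)
    (h : x.Factors (e ≫ f)) : x.Factors f := by
  have sq : CommSq (x.factorThru _ h) e x.arrow f := ⟨by simp⟩
  rw [← sq.fac_right]
  exact Subobject.factors_comp_arrow _

theorem le_iff_factors {X : C} (x y : Subobject X) :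
    x ≤ y ↔ ∀ (A : C) (f : A ⟶ X), x.Factors f → y.Factors f := by
  refine ⟨fun h A f => Subobject.factors_of_le f h, fun h => ?_⟩
  exact Subobject.le_of_comm (y.factorThru x.arrow (h _ _ ((Subobject.factors_iff _ _).2 ⟨𝟙 _, by simp⟩))) (by simp)

theorem ext_factors {X : C} {x y : Subobject X}
    (h : ∀ (A : C) (f : A ⟶ X), x.Factors f ↔ y.Factors f) : x = y :=
  le_antisymm ((le_iff_factors _ _).2 fun A f => (h A f).1)
    ((le_iff_factors _ _).2 fun A f => (h A f).2)

theorem factors_mk_iff {X Y A : C} (m : X ⟶ Y) [Mono m] (f : A ⟶ Y) :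
    (Subobject.mk m).Factors f ↔ ∃ g : A ⟶ X, g ≫ m = f :=
  Subobject.mk_factors_iff _ _

theorem factors_image {X Y A : C} (p : X ⟶ Y) (f : A ⟶ Y) :
    (Subobject.mk (image.ι p)).Factors f ↔
      ∃ (B : C) (e : B ⟶ A) (b : B ⟶ X), StrongEpi e ∧ b ≫ p = e ≫ f := by
  rw [factors_mk_iff]
  constructor
  · rintro ⟨g, rfl⟩
    have := strongEpi_pullback_fst g (factorThruImage p)
    refine ⟨_, pullback.fst g (factorThruImage p), pullback.snd _ _, this, ?_⟩
    rw [← Category.assoc, pullback.condition, Category.assoc, image.fac]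
  · rintro ⟨B, e, b, he, h⟩
    rw [← factors_mk_iff]
    apply factors_of_cover _ e
    rw [← h, factors_mk_iff]
    exact ⟨b ≫ factorThruImage p, by simp⟩

theorem factors_pullback {X Y A : C} (p : X ⟶ Y) (y : Subobject Y) (f : A ⟶ X) :
    ((Subobject.pullback p).obj y).Factors f ↔ y.Factors (f ≫ p) := by
  constructor
  · intro h
    have : f ≫ p = (Subobject.factorThru _ f h ≫ Subobject.pullbackπ p y) ≫ y.arrow := by
      rw [Category.assoc, (Subobject.isPullback p y).w, ← Category.assoc,
        Subobject.factorThru_arrow]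
    rw [this]
    exact Subobject.factors_comp_arrow _
  · intro h
    have : f = (Subobject.isPullback p y).lift (Subobject.factorThru _ _ h) f (by simp) ≫
        ((Subobject.pullback p).obj y).arrow := by simp
    rw [this]
    exact Subobject.factors_comp_arrow _

theorem factors_exists {X Y A : C} (p : X ⟶ Y) (x : Subobject X) (f : A ⟶ Y) :
    ((Subobject.exists p).obj x).Factors f ↔
      ∃ (B : C) (e : B ⟶ A) (b : B ⟶ X), StrongEpi e ∧ x.Factors b ∧ b ≫ p = e ≫ f := by
  have key : (Subobject.exists p).obj x = Subobject.mk (image.ι (x.arrow ≫ p)) := by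
    apply le_antisymm
    · apply (((Subobject.existsPullbackAdj p).homEquiv _ _).symm (homOfLE _)).le
      rw [le_iff_factors]
      intro A f hf
      rw [factors_pullback, factors_image]
      exact ⟨A, 𝟙 A, x.factorThru f hf, inferInstance, by simp⟩
    · have h : x ≤ (Subobject.pullback p).obj ((Subobject.exists p).obj x) :=
        ((Subobject.existsPullbackAdj p).unit.app x).le
      rw [le_iff_factors]
      intro A f hf
      obtain ⟨B, e, b, he, hb⟩ := (factors_image _ _).1 hf
      apply factors_of_cover _ e
      rw [← hb, ← Category.assoc, ← factors_pullback]
      exact Subobject.factors_of_le _ h (Subobject.factors_comp_arrow _)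
  rw [key, factors_image]
  constructor
  · rintro ⟨B, e, b, he, h⟩
    exact ⟨B, e, b ≫ x.arrow, he, Subobject.factors_comp_arrow _, by simpa using h⟩
  · rintro ⟨B, e, b, he, hb, h⟩
    exact ⟨B, e, x.factorThru b hb, he, by simpa using h⟩

end Covers

section Relations

variable {C : Type u} [Category.{v} C] [Regular C]

/-- A relation `x : r ⇸ s` is a subobject `x ⊆ r × s`, ordered as a subobject. -/
abbrev Reln (r s : C) := Subobject (r ⨯ s)

namespace Reln

/-- The graph `⟨id, f⟩ ⊆ r × s` of a morphism. -/
noncomputable def graph {r s : C} (f : r ⟶ s) : Reln r s := Subobject.mk (prod.lift (𝟙 r) f)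

/-- The co-graph `⟨f, id⟩ ⊆ s × r` of a morphism `f : r ⟶ s`, the right adjoint of its graph. -/
noncomputable def cograph {r s : C} (f : r ⟶ s) : Reln s r := Subobject.mk (prod.lift f (𝟙 r))

/-- Composition of relations: pull back over the middle object, then take the image in `r × t`. -/
noncomputable def comp {r s t : C} (x : Reln r s) (y : Reln s t) : Reln r t :=
  Subobject.mk (image.ι (prod.lift
    (pullback.fst (x.arrow ≫ prod.snd) (y.arrow ≫ prod.fst) ≫ x.arrow ≫ prod.fst)
    (pullback.snd (x.arrow ≫ prod.snd) (y.arrow ≫ prod.fst) ≫ y.arrow ≫ prod.snd)))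

/-- The monoidal product `x × y ⊆ (r × r') × (s × s')` of relations. -/
noncomputable def tensor {r s r' s' : C} (x : Reln r s) (y : Reln r' s') :
    Reln (r ⨯ r') (s ⨯ s') :=
  (Subobject.pullback (prod.map prod.fst prod.fst)).obj x ⊓
    (Subobject.pullback (prod.map prod.snd prod.snd)).obj y

/-- Generalized elements `a`, `b` are related by `x`. -/
def Holds {r s A : C} (x : Reln r s) (a : A ⟶ r) (b : A ⟶ s) : Prop := x.Factors (prod.lift a b)

theorem le_iff {r s : C} (x y : Reln r s) :
    x ≤ y ↔ ∀ (A : C) (a : A ⟶ r) (b : A ⟶ s), x.Holds a b → y.Holds a b := by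
  rw [le_iff_factors]
  refine ⟨fun h A a b => h A _, fun h A f hf => ?_⟩
  have e : f = prod.lift (f ≫ prod.fst) (f ≫ prod.snd) := by ext <;> simp
  rw [e] at hf ⊢
  exact h _ _ _ hf

theorem ext' {r s : C} {x y : Reln r s}
    (h : ∀ (A : C) (a : A ⟶ r) (b : A ⟶ s), x.Holds a b ↔ y.Holds a b) : x = y :=
  le_antisymm ((le_iff _ _).2 fun A a b => (h A a b).1) ((le_iff _ _).2 fun A a b => (h A a b).2)

theorem Holds.of_cover {r s A B : C} {x : Reln r s} {a : A ⟶ r} {b : A ⟶ s} (e : B ⟶ A)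
    [StrongEpi e] (h : x.Holds (e ≫ a) (e ≫ b)) : x.Holds a b := by
  apply factors_of_cover _ e
  rw [prod.comp_lift]; exact h

theorem Holds.precomp {r s A B : C} {x : Reln r s} {a : A ⟶ r} {b : A ⟶ s} (h : x.Holds a b)
    (e : B ⟶ A) : x.Holds (e ≫ a) (e ≫ b) := by
  unfold Holds; rw [← prod.comp_lift]; exact Subobject.factors_of_factors_right _ h

theorem holds_arrow {r s A : C} (x : Reln r s) (f : A ⟶ (x : C)) :
    x.Holds (f ≫ x.arrow ≫ prod.fst) (f ≫ x.arrow ≫ prod.snd) := by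
  have : prod.lift (f ≫ x.arrow ≫ prod.fst) (f ≫ x.arrow ≫ prod.snd) = f ≫ x.arrow := by
    ext <;> simp
  unfold Holds; rw [this]; exact Subobject.factors_comp_arrow _

theorem Holds.exists_arrow {r s A : C} {x : Reln r s} {a : A ⟶ r} {b : A ⟶ s} (h : x.Holds a b) :
    ∃ f : A ⟶ (x : C), f ≫ x.arrow ≫ prod.fst = a ∧ f ≫ x.arrow ≫ prod.snd = b :=
  have h' : x.Factors (prod.lift a b) := h
  ⟨x.factorThru _ h', by rw [← Category.assoc, Subobject.factorThru_arrow, prod.lift_fst],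
    by rw [← Category.assoc, Subobject.factorThru_arrow, prod.lift_snd]⟩

@[simp] theorem holds_graph {r s A : C} (f : r ⟶ s) (a : A ⟶ r) (b : A ⟶ s) :
    (graph f).Holds a b ↔ b = a ≫ f := by
  unfold Holds graph
  rw [factors_mk_iff]
  constructor
  · rintro ⟨g, hg⟩
    have h1 := congrArg (· ≫ prod.fst) hg
    have h2 := congrArg (· ≫ prod.snd) hg
    simp [-prod.comp_lift] at h1 h2
    rw [← h1, ← h2]
  · rintro rfl
    exact ⟨a, by simp⟩

@[simp] theorem holds_cograph {r s A : C} (f : r ⟶ s) (a : A ⟶ s) (b : A ⟶ r) :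
    (cograph f).Holds a b ↔ a = b ≫ f := by
  unfold Holds cograph
  rw [factors_mk_iff]
  constructor
  · rintro ⟨g, hg⟩
    have h1 := congrArg (· ≫ prod.fst) hg
    have h2 := congrArg (· ≫ prod.snd) hg
    simp [-prod.comp_lift] at h1 h2
    rw [← h1, ← h2]
  · rintro rfl
    exact ⟨b, by simp⟩

theorem holds_comp {r s t A : C} (x : Reln r s) (y : Reln s t) (a : A ⟶ r) (c : A ⟶ t) :
    (x.comp y).Holds a c ↔ ∃ (B : C) (e : B ⟶ A) (b : B ⟶ s), StrongEpi e ∧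
      x.Holds (e ≫ a) b ∧ y.Holds b (e ≫ c) := by
  unfold comp
  rw [Holds, factors_image]
  constructor
  · rintro ⟨B, e, b, he, h⟩
    have h1 := congrArg (· ≫ prod.fst) h
    have h2 := congrArg (· ≫ prod.snd) h
    simp [-prod.comp_lift] at h1 h2
    refine ⟨B, e, b ≫ pullback.fst _ _ ≫ x.arrow ≫ prod.snd, he, ?_, ?_⟩
    · rw [← h1]; simpa using holds_arrow x (b ≫ pullback.fst _ _)
    · rw [← h2, pullback.condition]; simpa using holds_arrow y (b ≫ pullback.snd _ _)
  · rintro ⟨B, e, b, he, hx, hy⟩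
    obtain ⟨f, hf1, hf2⟩ := hx.exists_arrow
    obtain ⟨g, hg1, hg2⟩ := hy.exists_arrow
    refine ⟨B, e, pullback.lift f g (by rw [hf2, hg1]), he, ?_⟩
    ext
    · simp [hf1]
    · simp [hg2]

@[simp] theorem holds_graph_comp {r s t A : C} (f : r ⟶ s) (y : Reln s t) (a : A ⟶ r) (c : A ⟶ t) :
    ((graph f).comp y).Holds a c ↔ y.Holds (a ≫ f) c := by
  rw [holds_comp]
  constructor
  · rintro ⟨B, e, b, he, hx, hy⟩
    rw [holds_graph] at hx
    subst hx
    rw [Category.assoc] at hy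
    exact hy.of_cover e
  · intro h
    exact ⟨A, 𝟙 A, a ≫ f, inferInstance, by simp, by simpa using h⟩

@[simp] theorem holds_comp_cograph {r s t A : C} (x : Reln r s) (f : t ⟶ s) (a : A ⟶ r)
    (c : A ⟶ t) : (x.comp (cograph f)).Holds a c ↔ x.Holds a (c ≫ f) := by
  rw [holds_comp]
  constructor
  · rintro ⟨B, e, b, he, hx, hy⟩
    rw [holds_cograph] at hy
    subst hy
    rw [Category.assoc] at hx
    exact hx.of_cover e
  · intro h
    exact ⟨A, 𝟙 A, c ≫ f, inferInstance, by simpa using h, by simp⟩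

@[simp] theorem holds_tensor {r s r' s' A : C} (x : Reln r s) (y : Reln r' s') (a : A ⟶ r ⨯ r')
    (b : A ⟶ s ⨯ s') : (x.tensor y).Holds a b ↔
      x.Holds (a ≫ prod.fst) (b ≫ prod.fst) ∧ y.Holds (a ≫ prod.snd) (b ≫ prod.snd) := by
  unfold Holds tensor
  rw [Subobject.inf_factors, factors_pullback, factors_pullback, prod.lift_map, prod.lift_map]

end Reln
end Relations

section RegularFunctors

variable {C : Type u} [Category.{v} C] [Regular C]
variable {D : Type u'} [Category.{v'} D] [Regular D]

/-- A regular functor preserves finite limits and regular epimorphisms. -/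
class IsRegularFunctor (G : D ⥤ C) : Prop extends PreservesFiniteLimits G where
  map_regularEpi : ∀ {X Y : D} (f : X ⟶ Y), IsRegularEpi f → IsRegularEpi (G.map f)

theorem IsRegularFunctor.map_strongEpi (G : D ⥤ C) [IsRegularFunctor G] {X Y : D} (f : X ⟶ Y)
    (hf : StrongEpi f) : StrongEpi (G.map f) := by
  have := IsRegularFunctor.map_regularEpi (G := G) f (isRegularEpi_of_strongEpi f)
  infer_instance

namespace Reln

variable (G : D ⥤ C) [IsRegularFunctor G]

instance mono_mapFunctor {r s : D} (x : Reln r s) :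
    Mono (prod.lift (G.map (x.arrow ≫ prod.fst)) (G.map (x.arrow ≫ prod.snd))) := by
  have : prod.lift (G.map (x.arrow ≫ prod.fst)) (G.map (x.arrow ≫ prod.snd)) =
      G.map x.arrow ≫ prodComparison G r s := by
    ext <;> simp
  rw [this]; infer_instance

/-- The action of the relations po-functor of a regular functor `G`: a relation `x ⊆ r × s` is
sent to `G x ⊆ G (r × s) ≅ G r × G s`. -/
noncomputable def mapFunctor {r s : D} (x : Reln r s) : Reln (G.obj r) (G.obj s) :=
  Subobject.mk (prod.lift (G.map (x.arrow ≫ prod.fst)) (G.map (x.arrow ≫ prod.snd)))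

theorem holds_mapFunctor {r s : D} {A : C} (x : Reln r s) (a : A ⟶ G.obj r) (b : A ⟶ G.obj s) :
    (mapFunctor G x).Holds a b ↔ ∃ f : A ⟶ G.obj (x : D),
      f ≫ G.map (x.arrow ≫ prod.fst) = a ∧ f ≫ G.map (x.arrow ≫ prod.snd) = b := by
  unfold Holds mapFunctor
  rw [factors_mk_iff]
  refine exists_congr fun f => ?_
  rw [prod.comp_lift]
  constructor
  · intro h
    have h1 := congrArg (· ≫ prod.fst) h
    have h2 := congrArg (· ≫ prod.snd) h
    simp only [prod.lift_fst, prod.lift_snd] at h1 h2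
    exact ⟨h1, h2⟩
  · rintro ⟨rfl, rfl⟩; rfl

theorem Holds.mapFunctor {r s A : D} {x : Reln r s} {a : A ⟶ r} {b : A ⟶ s} (h : x.Holds a b) :
    (mapFunctor G x).Holds (G.map a) (G.map b) := by
  obtain ⟨f, h1, h2⟩ := h.exists_arrow
  rw [holds_mapFunctor]
  exact ⟨G.map f, by rw [← G.map_comp, h1], by rw [← G.map_comp, h2]⟩

theorem mapFunctor_mono {r s : D} {x y : Reln r s} (h : x ≤ y) :
    Reln.mapFunctor G x ≤ Reln.mapFunctor G y := by
  rw [le_iff]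
  intro A a b hab
  obtain ⟨f, rfl, rfl⟩ := (holds_mapFunctor ..).1 hab
  have hx := holds_arrow x (𝟙 _)
  simp only [Category.id_comp] at hx
  exact (((le_iff _ _).1 h _ _ _ hx).mapFunctor G).precomp f

theorem mapFunctor_graph {r s : D} (f : r ⟶ s) :
    Reln.mapFunctor G (graph f) = graph (G.map f) := by
  apply ext'
  intro A a b
  rw [holds_graph]
  constructor
  · intro h
    obtain ⟨g, rfl, rfl⟩ := (holds_mapFunctor ..).1 h
    have hx := holds_arrow (graph f) (𝟙 _)
    rw [holds_graph] at hx
    simp only [Category.id_comp] at hx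
    rw [hx]; simp
  · rintro rfl
    have h : (graph f).Holds (𝟙 _) f := by simp
    simpa using (h.mapFunctor G).precomp a

theorem mapFunctor_cograph {r s : D} (f : r ⟶ s) :
    Reln.mapFunctor G (cograph f) = cograph (G.map f) := by
  apply ext'
  intro A a b
  rw [holds_cograph]
  constructor
  · intro h
    obtain ⟨g, rfl, rfl⟩ := (holds_mapFunctor ..).1 h
    have hx := holds_arrow (cograph f) (𝟙 _)
    rw [holds_cograph] at hx
    simp only [Category.id_comp] at hx
    rw [hx]; simp
  · rintro rfl
    have h : (cograph f).Holds f (𝟙 _) := by simp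
    simpa using (h.mapFunctor G).precomp b

theorem mapFunctor_comp {r s t : D} (x : Reln r s) (y : Reln s t) :
    Reln.mapFunctor G (x.comp y) = (Reln.mapFunctor G x).comp (Reln.mapFunctor G y) := by
  apply ext'
  intro A a c
  rw [holds_comp]
  constructor
  · intro h
    obtain ⟨g, rfl, rfl⟩ := (holds_mapFunctor ..).1 h
    have hx := holds_arrow (x.comp y) (𝟙 _)
    obtain ⟨B, e, b, he, h1, h2⟩ := (holds_comp ..).1 hx
    have := IsRegularFunctor.map_strongEpi G e he
    have := strongEpi_pullback_fst g (G.map e)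
    refine ⟨_, pullback.fst g (G.map e), pullback.snd g (G.map e) ≫ G.map b, this, ?_, ?_⟩
    · have := (h1.mapFunctor G).precomp (pullback.snd g (G.map e))
      simpa [pullback.condition_assoc] using this
    · have := (h2.mapFunctor G).precomp (pullback.snd g (G.map e))
      simpa [pullback.condition_assoc] using this
  · rintro ⟨B, e, b, he, hx, hy⟩
    obtain ⟨f, hf1, hf2⟩ := (holds_mapFunctor ..).1 hx
    obtain ⟨g, hg1, hg2⟩ := (holds_mapFunctor ..).1 hy
    have hp := (IsPullback.of_hasPullback (x.arrow ≫ prod.snd) (y.arrow ≫ prod.fst)).map G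
    have h : (x.comp y).Holds (pullback.fst (x.arrow ≫ prod.snd) (y.arrow ≫ prod.fst) ≫
        x.arrow ≫ prod.fst) (pullback.snd (x.arrow ≫ prod.snd) (y.arrow ≫ prod.fst) ≫
        y.arrow ≫ prod.snd) := by
      rw [holds_comp]
      refine ⟨_, 𝟙 _, pullback.fst (x.arrow ≫ prod.snd) (y.arrow ≫ prod.fst) ≫
        x.arrow ≫ prod.snd, inferInstance, ?_, ?_⟩
      · rw [Category.id_comp]; exact holds_arrow _ _
      · rw [Category.id_comp, pullback.condition]; exact holds_arrow _ _
    obtain ⟨l, hl1, hl2⟩ := hp.exists_lift f g (hf2.trans hg1.symm)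
    have h' := (h.mapFunctor G).precomp l
    rw [G.map_comp (pullback.fst _ _), G.map_comp (pullback.snd _ _), ← Category.assoc, hl1,
      ← Category.assoc, hl2, hf1, hg2] at h'
    exact h'.of_cover e

/-- The comparison isomorphism `G r × G s ≅ G (r × s)`. -/
noncomputable def prodIso (r s : D) : G.obj r ⨯ G.obj s ≅ G.obj (r ⨯ s) :=
  (PreservesLimitPair.iso G r s).symm

@[simp] theorem prodIso_hom_fst (r s : D) :
    (prodIso G r s).hom ≫ G.map prod.fst = prod.fst := by
  simp [prodIso]

@[simp] theorem prodIso_hom_snd (r s : D) :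
    (prodIso G r s).hom ≫ G.map prod.snd = prod.snd := by
  simp [prodIso]

@[simp] theorem prodIso_inv_fst (r s : D) :
    (prodIso G r s).inv ≫ prod.fst = G.map prod.fst := by
  simp [prodIso]

@[simp] theorem prodIso_inv_snd (r s : D) :
    (prodIso G r s).inv ≫ prod.snd = G.map prod.snd := by
  simp [prodIso]

@[simp] theorem prodIso_hom_fst_assoc (r s : D) {A : C} (h : G.obj r ⟶ A) :
    (prodIso G r s).hom ≫ G.map prod.fst ≫ h = prod.fst ≫ h := by
  rw [← Category.assoc, prodIso_hom_fst]

@[simp] theorem prodIso_hom_snd_assoc (r s : D) {A : C} (h : G.obj s ⟶ A) :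
    (prodIso G r s).hom ≫ G.map prod.snd ≫ h = prod.snd ≫ h := by
  rw [← Category.assoc, prodIso_hom_snd]

@[simp] theorem prodIso_inv_fst_assoc (r s : D) {A : C} (h : G.obj r ⟶ A) :
    (prodIso G r s).inv ≫ prod.fst ≫ h = G.map prod.fst ≫ h := by
  rw [← Category.assoc, prodIso_inv_fst]

@[simp] theorem prodIso_inv_snd_assoc (r s : D) {A : C} (h : G.obj s ⟶ A) :
    (prodIso G r s).inv ≫ prod.snd ≫ h = G.map prod.snd ≫ h := by
  rw [← Category.assoc, prodIso_inv_snd]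

theorem hom_ext_prod {r s : D} {A : C} {a b : A ⟶ G.obj (r ⨯ s)}
    (h1 : a ≫ G.map prod.fst = b ≫ G.map prod.fst)
    (h2 : a ≫ G.map prod.snd = b ≫ G.map prod.snd) : a = b := by
  rw [← cancel_mono (prodIso G r s).inv]
  ext <;> simpa

theorem holds_mapFunctor_tensor {r s r' s' : D} (x : Reln r s) (y : Reln r' s') {A : C}
    (a : A ⟶ G.obj (r ⨯ r')) (b : A ⟶ G.obj (s ⨯ s')) :
    (Reln.mapFunctor G (x.tensor y)).Holds a b ↔
      (Reln.mapFunctor G x).Holds (a ≫ G.map prod.fst) (b ≫ G.map prod.fst) ∧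
      (Reln.mapFunctor G y).Holds (a ≫ G.map prod.snd) (b ≫ G.map prod.snd) := by
  constructor
  · intro h
    obtain ⟨g, rfl, rfl⟩ := (holds_mapFunctor ..).1 h
    have hx := holds_arrow (x.tensor y) (𝟙 _)
    obtain ⟨h1, h2⟩ := (holds_tensor ..).1 hx
    exact ⟨by simpa using (h1.mapFunctor G).precomp g, by simpa using (h2.mapFunctor G).precomp g⟩
  · rintro ⟨hx, hy⟩
    obtain ⟨f, hf1, hf2⟩ := (holds_mapFunctor ..).1 hx
    obtain ⟨g, hg1, hg2⟩ := (holds_mapFunctor ..).1 hy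
    have h : (x.tensor y).Holds (prod.map (x.arrow ≫ prod.fst) (y.arrow ≫ prod.fst))
        (prod.map (x.arrow ≫ prod.snd) (y.arrow ≫ prod.snd)) := by
      rw [holds_tensor]
      simp only [prod.map_fst, prod.map_snd]
      exact ⟨holds_arrow _ _, holds_arrow _ _⟩
    have h' := (h.mapFunctor G).precomp (prod.lift f g ≫ (prodIso G _ _).hom)
    convert h' using 1
    · apply hom_ext_prod
      · rw [← hf1, Category.assoc, Category.assoc, ← G.map_comp, prod.map_fst, G.map_comp prod.fst,
          prodIso_hom_fst_assoc, prod.lift_fst_assoc]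
      · rw [← hg1, Category.assoc, Category.assoc, ← G.map_comp, prod.map_snd, G.map_comp prod.snd,
          prodIso_hom_snd_assoc, prod.lift_snd_assoc]
    · apply hom_ext_prod
      · rw [← hf2, Category.assoc, Category.assoc, ← G.map_comp, prod.map_fst, G.map_comp prod.fst,
          prodIso_hom_fst_assoc, prod.lift_fst_assoc]
      · rw [← hg2, Category.assoc, Category.assoc, ← G.map_comp, prod.map_snd, G.map_comp prod.snd,
          prodIso_hom_snd_assoc, prod.lift_snd_assoc]

end Reln
end RegularFunctors

section Ajax

/-- An ajax (adjoint-lax) po-functor from the symmetric monoidal po-category of relations of a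
regular category `C` (with monoidal product given by the cartesian product of `C`) to the po-category
of posets: a lax symmetric monoidal po-functor whose laxators are right adjoints. -/
structure AjaxFunctor (C : Type u) [Category.{v} C] [Regular C] where
  /-- the poset assigned to an object -/
  obj : C → Type w
  [order : ∀ X, PartialOrder (obj X)]
  /-- the monotone map assigned to a relation -/
  map : ∀ {X Y : C}, Reln X Y → obj X →o obj Y
  map_id : ∀ {X : C} (a : obj X), map (Reln.graph (𝟙 X)) a = a
  map_comp : ∀ {X Y Z : C} (x : Reln X Y) (y : Reln Y Z) (a : obj X),
    map (x.comp y) a = map y (map x a)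
  map_mono : ∀ {X Y : C} {x y : Reln X Y}, x ≤ y → ∀ a : obj X, map x a ≤ map y a
  /-- the nullary laxator `1 → P(I)` -/
  unit : obj (⊤_ C)
  /-- the binary laxator -/
  lax : ∀ {X Y : C}, obj X × obj Y →o obj (X ⨯ Y)
  lax_natural : ∀ {X Y X' Y' : C} (x : Reln X Y) (y : Reln X' Y') (a : obj X) (b : obj X'),
    lax (map x a, map y b) = map (x.tensor y) (lax (a, b))
  lax_assoc : ∀ {X Y Z : C} (a : obj X) (b : obj Y) (c : obj Z),
    map (Reln.graph (prod.associator X Y Z).hom) (lax (lax (a, b), c)) = lax (a, lax (b, c))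
  lax_unit_left : ∀ {X : C} (a : obj X),
    map (Reln.graph (prod.leftUnitor X).hom) (lax (unit, a)) = a
  lax_unit_right : ∀ {X : C} (a : obj X),
    map (Reln.graph (prod.rightUnitor X).hom) (lax (a, unit)) = a
  lax_braiding : ∀ {X Y : C} (a : obj X) (b : obj Y),
    map (Reln.graph (prod.braiding X Y).hom) (lax (a, b)) = lax (b, a)
  unit_rightAdjoint : ∃ l : obj (⊤_ C) → PUnit.{1}, GaloisConnection l fun _ => unit
  lax_rightAdjoint : ∀ X Y : C, ∃ l : obj (X ⨯ Y) → obj X × obj Y, GaloisConnection l lax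

attribute [instance] AjaxFunctor.order

namespace Reln

variable {C : Type u} [Category.{v} C] [Regular C]

@[simp] theorem graph_comp_graph {r s t : C} (f : r ⟶ s) (g : s ⟶ t) :
    (graph f).comp (graph g) = graph (f ≫ g) := ext' fun A a b => by simp

theorem holds_cograph_comp_graph {r s t A : C} (d : s ⟶ r) (p : s ⟶ t) (a : A ⟶ r) (c : A ⟶ t) :
    ((cograph d).comp (graph p)).Holds a c ↔ ∃ (B : C) (e : B ⟶ A) (b : B ⟶ s), StrongEpi e ∧
      e ≫ a = b ≫ d ∧ e ≫ c = b ≫ p := by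
  simp [holds_comp]

/-- The morphism `(X × Y) × (Y × Z) ⇸ X × Z` that glues the two copies of `Y` together and
hides them. -/
noncomputable def compDiagram (X Y Z : C) : Reln ((X ⨯ Y) ⨯ (Y ⨯ Z)) (X ⨯ Z) :=
  (cograph (prod.lift (prod.map (𝟙 X) prod.fst) prod.snd :
    X ⨯ (Y ⨯ Z) ⟶ (X ⨯ Y) ⨯ (Y ⨯ Z))).comp (graph (prod.map (𝟙 X) prod.snd))

theorem holds_compDiagram {X Y Z A : C} (a : A ⟶ (X ⨯ Y) ⨯ (Y ⨯ Z)) (c : A ⟶ X ⨯ Z) :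
    (compDiagram X Y Z).Holds a c ↔ a ≫ prod.fst ≫ prod.snd = a ≫ prod.snd ≫ prod.fst ∧
      c ≫ prod.fst = a ≫ prod.fst ≫ prod.fst ∧ c ≫ prod.snd = a ≫ prod.snd ≫ prod.snd := by
  rw [compDiagram, holds_cograph_comp_graph]
  constructor
  · rintro ⟨B, e, b, he, h1, h2⟩
    refine ⟨?_, ?_, ?_⟩ <;> rw [← cancel_epi e] <;>
      simp only [← Category.assoc, h1, h2] <;> simp
  · rintro ⟨h1, h2, h3⟩
    refine ⟨A, 𝟙 A, prod.lift (a ≫ prod.fst ≫ prod.fst) (a ≫ prod.snd), inferInstance, ?_, ?_⟩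
    · ext <;> simp [h1]
    · ext <;> simp [h2, h3]

end Reln

namespace AjaxFunctor

open Reln

variable {C : Type u} [Category.{v} C] [Regular C] (P : AjaxFunctor.{u, v, w} C)

theorem map_map {X Y Z : C} (x : Reln X Y) (y : Reln Y Z) (a : P.obj X) :
    P.map y (P.map x a) = P.map (x.comp y) a := (P.map_comp _ _ _).symm

theorem lax_map_left {X Y X' : C} (x : Reln X Y) (a : P.obj X) (b : P.obj X') :
    P.lax (P.map x a, b) = P.map (x.tensor (graph (𝟙 X'))) (P.lax (a, b)) := by
  rw [← P.lax_natural, P.map_id]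

theorem lax_map_right {X Y X' : C} (x : Reln X Y) (a : P.obj X) (b : P.obj X') :
    P.lax (b, P.map x a) = P.map ((graph (𝟙 X')).tensor x) (P.lax (b, a)) := by
  rw [← P.lax_natural, P.map_id]

theorem le_map_cograph {X Y : C} (f : X ⟶ Y) (a : P.obj X) (b : P.obj Y)
    (h : P.map (graph f) a ≤ b) : a ≤ P.map (cograph f) b := by
  refine le_trans ?_ ((P.map (cograph f)).monotone h)
  rw [map_map]
  conv_lhs => rw [← P.map_id a]
  apply P.map_mono
  rw [le_iff]
  intro A a b h
  simp only [holds_graph, holds_comp_cograph] at *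
  simp [h]

/-- The top element `true` of `P(X)`. -/
noncomputable def truth (X : C) : P.obj X := P.map (cograph (terminal.from X)) P.unit

theorem le_truth {X : C} (a : P.obj X) : a ≤ P.truth X := by
  apply P.le_map_cograph
  obtain ⟨l, hl⟩ := P.unit_rightAdjoint
  exact (hl _ PUnit.unit).1 le_rfl

/-- The binary meet in `P(X)`. -/
noncomputable def meet {X : C} (a b : P.obj X) : P.obj X := P.map (cograph (diag X)) (P.lax (a, b))

theorem meet_mono {X : C} {a b a' b' : P.obj X} (h : a ≤ a') (h' : b ≤ b') :
    P.meet a b ≤ P.meet a' b' :=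
  (P.map _).monotone (P.lax.monotone ⟨h, h'⟩)

theorem truth_meet {X : C} (a : P.obj X) : P.meet (P.truth X) a = a := by
  conv_rhs => rw [← P.lax_unit_left a]
  unfold meet truth
  rw [lax_map_left, map_map]
  congr 1
  congr 1
  apply ext'
  intro A a b
  simp only [holds_comp_cograph, holds_tensor, holds_cograph, holds_graph, diag, prod.lift_fst,
    prod.lift_snd, prod.comp_lift, Category.comp_id, prod.leftUnitor_hom]
  exact ⟨fun h => h.2, fun h => ⟨Subsingleton.elim _ _, h⟩⟩

theorem meet_truth {X : C} (a : P.obj X) : P.meet a (P.truth X) = a := by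
  conv_rhs => rw [← P.lax_unit_right a]
  unfold meet truth
  rw [lax_map_right, map_map]
  congr 1
  congr 1
  apply ext'
  intro A a b
  simp only [holds_comp_cograph, holds_tensor, holds_cograph, holds_graph, diag, prod.lift_fst,
    prod.lift_snd, prod.comp_lift, Category.comp_id, prod.rightUnitor_hom]
  exact ⟨fun h => h.1, fun h => ⟨h, Subsingleton.elim _ _⟩⟩

theorem le_meet_self {X : C} (a : P.obj X) : a ≤ P.meet a a := by
  obtain ⟨l, hl⟩ := P.lax_rightAdjoint X X
  have key : ∀ b c : P.obj X, l (P.map (graph (diag X)) a) ≤ (b, c) ↔ a ≤ P.meet b c := by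
    intro b c
    rw [hl]
    constructor
    · exact P.le_map_cograph _ _ _
    · intro h
      refine le_trans ((P.map _).monotone h) ?_
      unfold meet
      rw [map_map]
      conv_rhs => rw [← P.map_id (P.lax (b, c))]
      apply P.map_mono
      rw [le_iff]
      intro A a b h
      rw [holds_cograph_comp_graph] at h
      obtain ⟨B, e, t, he, h1, h2⟩ := h
      rw [holds_graph, ← cancel_epi e, h2, ← h1, Category.comp_id]
  rw [← key]
  have h1 := (key a (P.truth X)).2 (P.meet_truth a).ge
  have h2 := (key (P.truth X) a).2 (P.truth_meet a).ge
  exact ⟨h1.1, h2.2⟩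

end AjaxFunctor

end Ajax
section LeftAdjoints

/-- A po-category: a category whose hom-sets are posets and whose composition is monotone. -/
class PoCategory (K : Type u) extends Category.{v} K where
  [homOrder : ∀ X Y : K, PartialOrder (X ⟶ Y)]
  comp_mono : ∀ {X Y Z : K} {f f' : X ⟶ Y} {g g' : Y ⟶ Z}, f ≤ f' → g ≤ g' → f ≫ g ≤ f' ≫ g'

attribute [instance, reducible] PoCategory.homOrder

/-- A morphism of a po-category is a left adjoint if it has a right adjoint. -/
def IsLeftAdj {K : Type u} [PoCategory.{u, v} K] {X Y : K} (f : X ⟶ Y) : Prop :=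
  ∃ g : Y ⟶ X, 𝟙 X ≤ f ≫ g ∧ g ≫ f ≤ 𝟙 Y

/-- The category of left adjoints of a po-category: the same objects, and as morphisms the left
adjoints. -/
@[ext] structure LAdj (K : Type u) where
  /-- the underlying object -/
  of : K

namespace LAdj

variable {K : Type u} [PoCategory.{u, v} K]

theorem isLeftAdj_id (X : K) : IsLeftAdj (𝟙 X) := ⟨𝟙 X, by simp, by simp⟩

theorem isLeftAdj_comp {X Y Z : K} {f : X ⟶ Y} {g : Y ⟶ Z} (hf : IsLeftAdj f)
    (hg : IsLeftAdj g) : IsLeftAdj (f ≫ g) := by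
  obtain ⟨f', h1, h2⟩ := hf
  obtain ⟨g', h3, h4⟩ := hg
  refine ⟨g' ≫ f', ?_, ?_⟩
  · have := PoCategory.comp_mono (le_refl f) (PoCategory.comp_mono h3 (le_refl f'))
    simp only [Category.id_comp, Category.assoc] at this ⊢
    exact h1.trans this
  · have := PoCategory.comp_mono (le_refl g') (PoCategory.comp_mono h2 (le_refl g))
    simp only [Category.id_comp, Category.assoc] at this ⊢
    exact this.trans h4

instance : Category.{v} (LAdj K) where
  Hom X Y := {f : X.of ⟶ Y.of // IsLeftAdj f}
  id X := ⟨𝟙 X.of, isLeftAdj_id _⟩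
  comp f g := ⟨f.1 ≫ g.1, isLeftAdj_comp f.2 g.2⟩
  id_comp _ := Subtype.ext (Category.id_comp _)
  comp_id _ := Subtype.ext (Category.comp_id _)
  assoc _ _ _ := Subtype.ext (Category.assoc _ _ _)

/-- A po-functor restricts to left adjoints. -/
def mapFunctor {L : Type u'} [PoCategory.{u', v'} L] (F : K ⥤ L)
    (hF : ∀ {X Y : K} {f g : X ⟶ Y}, f ≤ g → F.map f ≤ F.map g) : LAdj K ⥤ LAdj L where
  obj X := ⟨F.obj X.of⟩
  map f := ⟨F.map f.1, by
    obtain ⟨g, h1, h2⟩ := f.2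
    exact ⟨F.map g, by rw [← F.map_comp, ← F.map_id]; exact hF h1,
      by rw [← F.map_comp, ← F.map_id]; exact hF h2⟩⟩
  map_id X := Subtype.ext (F.map_id _)
  map_comp f g := Subtype.ext (F.map_comp _ _)

end LAdj

end LeftAdjoints

section InternalRelations

open Reln

variable {C : Type u} [Category.{v} C] [Regular C]

namespace AjaxFunctor

variable (P : AjaxFunctor.{u, v, w} C)

theorem map_fst_lax_le {X Y : C} (a : P.obj X) (b : P.obj Y) :
    P.map (graph prod.fst) (P.lax (a, b)) ≤ a := by
  refine le_trans ((P.map _).monotone (P.lax.monotone (⟨le_rfl, P.le_truth b⟩ :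
    (a, b) ≤ (a, P.truth Y)))) ?_
  conv_rhs => rw [← P.lax_unit_right a]
  rw [truth, lax_map_right, map_map]
  apply P.map_mono
  rw [le_iff]
  intro A s t h
  rw [holds_comp] at h
  obtain ⟨B, e, p, he, h1, h2⟩ := h
  rw [holds_tensor] at h1
  simp only [holds_graph, Category.assoc, Category.comp_id, prod.rightUnitor_hom] at h1 h2 ⊢
  rw [← cancel_epi e, h2, h1.1]

theorem map_snd_lax_le {X Y : C} (a : P.obj X) (b : P.obj Y) :
    P.map (graph prod.snd) (P.lax (a, b)) ≤ b := by
  rw [← P.lax_braiding b a, map_map, graph_comp_graph, prod.braiding_hom, prod.lift_snd]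
  exact P.map_fst_lax_le b a

/-- The composite of two elements of `P(X × Y)` and `P(Y × Z)`, regarded as relations. -/
noncomputable def relComp {X Y Z : C} (a : P.obj (X ⨯ Y)) (b : P.obj (Y ⨯ Z)) : P.obj (X ⨯ Z) :=
  P.map (compDiagram X Y Z) (P.lax (a, b))

/-- The identity relation on `φ ∈ P(X)`. -/
noncomputable def relId {X : C} (φ : P.obj X) : P.obj (X ⨯ X) := P.map (graph (diag X)) φ

theorem relComp_mono {X Y Z : C} {a a' : P.obj (X ⨯ Y)} {b b' : P.obj (Y ⨯ Z)} (h : a ≤ a')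
    (h' : b ≤ b') : P.relComp a b ≤ P.relComp a' b' :=
  (P.map _).monotone (P.lax.monotone ⟨h, h'⟩)

theorem map_fst_relComp_le {X Y Z : C} (a : P.obj (X ⨯ Y)) (b : P.obj (Y ⨯ Z)) :
    P.map (graph prod.fst) (P.relComp a b) ≤ P.map (graph prod.fst) a := by
  refine le_trans ?_ ((P.map (graph prod.fst)).monotone (P.map_fst_lax_le a b))
  rw [relComp, map_map, map_map]
  apply P.map_mono
  rw [le_iff]
  intro A s t h
  rw [holds_comp] at h
  obtain ⟨B, e, p, he, h1, h2⟩ := h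
  rw [holds_compDiagram] at h1
  rw [graph_comp_graph, holds_graph, ← cancel_epi e]
  rw [holds_graph] at h2
  rw [h2, h1.2.1, Category.assoc]

theorem map_snd_relComp_le {X Y Z : C} (a : P.obj (X ⨯ Y)) (b : P.obj (Y ⨯ Z)) :
    P.map (graph prod.snd) (P.relComp a b) ≤ P.map (graph prod.snd) b := by
  refine le_trans ?_ ((P.map (graph prod.snd)).monotone (P.map_snd_lax_le a b))
  rw [relComp, map_map, map_map]
  apply P.map_mono
  rw [le_iff]
  intro A s t h
  rw [holds_comp] at h
  obtain ⟨B, e, p, he, h1, h2⟩ := h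
  rw [holds_compDiagram] at h1
  rw [graph_comp_graph, holds_graph, ← cancel_epi e]
  rw [holds_graph] at h2
  rw [h2, h1.2.2, Category.assoc]

theorem relId_relComp {X Y : C} (φ : P.obj X) (a : P.obj (X ⨯ Y))
    (h : P.map (graph prod.fst) a ≤ φ) : P.relComp (P.relId φ) a = a := by
  have key : P.relComp (P.relId φ) a = P.meet (P.map (cograph prod.fst) φ) a := by
    rw [relComp, relId, meet, lax_map_left, map_map, lax_map_left, map_map]
    congr 1
    congr 1
    apply ext'
    intro A s t
    rw [holds_comp, holds_comp_cograph]
    simp only [holds_tensor, holds_graph, holds_cograph, holds_compDiagram, Category.assoc,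
      Category.comp_id]
    constructor
    · rintro ⟨B, e, b, he, ⟨h1, h2⟩, h3, h4, h5⟩
      have h1' := congrArg (· ≫ prod.fst) h1
      have h1'' := congrArg (· ≫ prod.snd) h1
      simp at h1' h1''
      constructor <;> rw [← cancel_epi e]
      · simp [h4, ← h1']
      · ext
        · simp [h4, h1', ← h1'', h3, reassoc_of% h2]
        · simp [h5, reassoc_of% h2]
    · rintro ⟨h1, h2⟩
      refine ⟨A, 𝟙 A, prod.lift (s ≫ prod.fst ≫ diag _) (s ≫ prod.snd), inferInstance, ?_⟩
      simp at h1 h2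
      simp [h1, h2]
  rw [key]
  apply le_antisymm
  · calc _ ≤ P.meet (P.truth _) a := P.meet_mono (P.le_truth _) le_rfl
      _ = a := P.truth_meet a
  · exact (P.le_meet_self a).trans (P.meet_mono (P.le_map_cograph _ _ _ h) le_rfl)

theorem relComp_relId {X Y : C} (φ : P.obj Y) (a : P.obj (X ⨯ Y))
    (h : P.map (graph prod.snd) a ≤ φ) : P.relComp a (P.relId φ) = a := by
  have key : P.relComp a (P.relId φ) = P.meet a (P.map (cograph prod.snd) φ) := by
    rw [relComp, relId, meet, lax_map_right, map_map, lax_map_right, map_map]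
    congr 1
    congr 1
    apply ext'
    intro A s t
    rw [holds_comp, holds_comp_cograph]
    simp only [holds_tensor, holds_graph, holds_cograph, holds_compDiagram, Category.assoc,
      Category.comp_id]
    constructor
    · rintro ⟨B, e, b, he, ⟨h2, h1⟩, h3, h4, h5⟩
      have h1' := congrArg (· ≫ prod.fst) h1
      have h1'' := congrArg (· ≫ prod.snd) h1
      simp at h1' h1''
      constructor <;> rw [← cancel_epi e]
      · ext
        · simp [h4, reassoc_of% h2]
        · simp [h5, h1'', ← h1', ← h3, reassoc_of% h2]
      · simp [h5, ← h1'']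
    · rintro ⟨h1, h2⟩
      refine ⟨A, 𝟙 A, prod.lift (s ≫ prod.fst) (s ≫ prod.snd ≫ diag _), inferInstance, ?_⟩
      simp at h1 h2
      simp [h1, h2]
  rw [key]
  apply le_antisymm
  · calc _ ≤ P.meet a (P.truth _) := P.meet_mono le_rfl (P.le_truth _)
      _ = a := P.meet_truth a
  · exact (P.le_meet_self a).trans (P.meet_mono le_rfl (P.le_map_cograph _ _ _ h))

theorem relComp_assoc {X Y Z W : C} (a : P.obj (X ⨯ Y)) (b : P.obj (Y ⨯ Z)) (c : P.obj (Z ⨯ W)) :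
    P.relComp (P.relComp a b) c = P.relComp a (P.relComp b c) := by
  simp only [relComp]
  rw [lax_map_left, lax_map_right, ← P.lax_assoc, map_map, map_map, map_map]
  congr 1
  congr 1
  apply ext'
  intro A s t
  rw [holds_graph_comp, holds_comp, holds_comp]
  simp only [holds_tensor, holds_graph, holds_compDiagram, Category.assoc,
    Category.comp_id]
  constructor
  · rintro ⟨B, e, p, he, ⟨⟨h1, h2, h3⟩, h4⟩, h5, h6, h7⟩
    have h4' := congrArg (· ≫ prod.fst) h4
    have h4'' := congrArg (· ≫ prod.snd) h4
    simp at h4' h4''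
    refine ⟨B, e, prod.lift (e ≫ s ≫ prod.fst ≫ prod.fst)
      (prod.lift (e ≫ s ≫ prod.fst ≫ prod.snd ≫ prod.fst) (e ≫ s ≫ prod.snd ≫ prod.snd)), he, ?_⟩
    simp_all
  · rintro ⟨B, e, p, he, ⟨h4, ⟨h1, h2, h3⟩⟩, h5, h6, h7⟩
    have h4' := congrArg (· ≫ prod.fst) h4
    have h4'' := congrArg (· ≫ prod.snd) h4
    simp at h4' h4''
    refine ⟨B, e, prod.lift (prod.lift (e ≫ s ≫ prod.fst ≫ prod.fst ≫ prod.fst)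
      (e ≫ s ≫ prod.fst ≫ prod.snd ≫ prod.snd)) (e ≫ s ≫ prod.snd), he, ?_⟩
    simp_all

end AjaxFunctor

/-- The objects of the po-category of internal relations of `P`: an object `ctx` of `C` with an
element `pred` of the poset `P(ctx)`. -/
@[ext] structure IntRel (P : AjaxFunctor.{u, v, w} C) where
  /-- the context -/
  ctx : C
  /-- the element of the poset of the context -/
  pred : P.obj ctx

namespace IntRel

variable {P : AjaxFunctor.{u, v, w} C}

/-- An internal relation from `(X, φ)` to `(Y, ψ)`: an element of `P(X × Y)` whose direct images
along the projections lie below `φ` and `ψ`. -/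
abbrev Hom (X Y : IntRel P) : Type w :=
  {θ : P.obj (X.ctx ⨯ Y.ctx) //
    P.map (graph prod.fst) θ ≤ X.pred ∧ P.map (graph prod.snd) θ ≤ Y.pred}

/-- Internal relations form a po-category. -/
noncomputable instance : PoCategory.{max u w, w} (IntRel P) where
  Hom := Hom
  id X := ⟨P.relId X.pred, by
    simp only [AjaxFunctor.relId, AjaxFunctor.map_map, graph_comp_graph, diag, prod.lift_fst,
      prod.lift_snd, P.map_id]
    exact ⟨le_rfl, le_rfl⟩⟩
  comp f g := ⟨P.relComp f.1 g.1, (P.map_fst_relComp_le _ _).trans f.2.1,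
    (P.map_snd_relComp_le _ _).trans g.2.2⟩
  id_comp f := Subtype.ext (P.relId_relComp _ _ f.2.1)
  comp_id f := Subtype.ext (P.relComp_relId _ _ f.2.2)
  assoc f g h := Subtype.ext (P.relComp_assoc _ _ _)
  homOrder X Y := inferInstanceAs (PartialOrder {θ : P.obj (X.ctx ⨯ Y.ctx) //
    P.map (graph prod.fst) θ ≤ X.pred ∧ P.map (graph prod.snd) θ ≤ Y.pred})
  comp_mono h h' := P.relComp_mono h h'

end IntRel

end InternalRelations

section ChangeOfBase

open Reln

variable {C : Type u} [Category.{v} C] [Regular C]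
variable {D : Type u'} [Category.{v'} D] [Regular D]

namespace Reln

theorem graph_iso {r s : C} (f : r ≅ s) : graph f.hom = cograph f.inv :=
  ext' fun A a b => by rw [holds_graph, holds_cograph, Iso.eq_comp_inv, eq_comm]

@[simp] theorem graph_tensor_graph {r s r' s' : C} (f : r ⟶ s) (g : r' ⟶ s') :
    (graph f).tensor (graph g) = graph (prod.map f g) := ext' fun A a b => by
  rw [holds_tensor, holds_graph, holds_graph, holds_graph]
  constructor
  · rintro ⟨h1, h2⟩
    ext
    · simpa using h1
    · simpa using h2
  · rintro rfl
    simp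

variable (G : D ⥤ C) [IsRegularFunctor G]

theorem holds_mapFunctor_compDiagram {X Y Z : D} {A : C} (a : A ⟶ G.obj ((X ⨯ Y) ⨯ (Y ⨯ Z)))
    (c : A ⟶ G.obj (X ⨯ Z)) : (mapFunctor G (compDiagram X Y Z)).Holds a c ↔
      a ≫ G.map (prod.fst ≫ prod.snd) = a ≫ G.map (prod.snd ≫ prod.fst) ∧
      c ≫ G.map prod.fst = a ≫ G.map (prod.fst ≫ prod.fst) ∧
      c ≫ G.map prod.snd = a ≫ G.map (prod.snd ≫ prod.snd) := by
  constructor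
  · intro h
    obtain ⟨g, rfl, rfl⟩ := (holds_mapFunctor ..).1 h
    obtain ⟨h1, h2, h3⟩ := (holds_compDiagram _ _).1 (holds_arrow (compDiagram X Y Z) (𝟙 _))
    simp only [Category.assoc, Category.id_comp] at h1 h2 h3
    simp only [Category.assoc, ← G.map_comp, h1, h2, h3, true_and]
  · rintro ⟨h1, h2, h3⟩
    rw [compDiagram, mapFunctor_comp, mapFunctor_graph, mapFunctor_cograph,
      holds_cograph_comp_graph]
    refine ⟨A, 𝟙 A, prod.lift (a ≫ G.map (prod.fst ≫ prod.fst)) (a ≫ G.map prod.snd) ≫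
      (prodIso G _ _).hom, inferInstance, ?_, ?_⟩
    · apply hom_ext_prod
      · simp only [Category.assoc, ← G.map_comp, prod.lift_fst, Category.id_comp]
        apply hom_ext_prod
        · simp [-Functor.map_comp, ← G.map_comp]
        · simp [-Functor.map_comp, ← G.map_comp]
          simpa using h1
      · simp [-Functor.map_comp, ← G.map_comp]
    · apply hom_ext_prod
      · simp [-Functor.map_comp, ← G.map_comp, h2]
      · simp [-Functor.map_comp, ← G.map_comp, h3]
        simp

end Reln

namespace AjaxFunctor

/-- The composite of an ajax po-functor with the po-functor on relations induced by a regular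
functor `G`; its laxators are those of `P`, transported along the isomorphisms by which `G`
preserves finite products. -/
noncomputable abbrev comp (P : AjaxFunctor.{u, v, w} C) (G : D ⥤ C) [IsRegularFunctor G] :
    AjaxFunctor.{u', v', w} D where
  obj X := P.obj (G.obj X)
  map x := P.map (mapFunctor G x)
  map_id a := by rw [mapFunctor_graph, G.map_id, P.map_id]
  map_comp x y a := by rw [mapFunctor_comp, P.map_comp]
  map_mono h a := P.map_mono (mapFunctor_mono G h) a
  unit := P.map (graph (PreservesTerminal.iso G).inv) P.unit
  lax := (P.map (graph (prodIso G _ _).hom)).comp P.lax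
  lax_natural {X Y X' Y'} x y a b := by
    simp only [OrderHom.comp_coe, Function.comp_apply]
    rw [P.lax_natural, map_map, map_map]
    congr 1
    congr 1
    apply ext'
    intro A a b
    rw [graph_iso (prodIso G Y Y'), holds_comp_cograph, holds_graph_comp, holds_tensor,
      holds_mapFunctor_tensor]
    simp
  lax_assoc {X Y Z} a b c := by
    simp only [OrderHom.comp_coe, Function.comp_apply]
    rw [lax_map_left, lax_map_right, ← P.lax_assoc, map_map, map_map, map_map, map_map,
      mapFunctor_graph]
    simp only [graph_comp_graph, graph_tensor_graph]
    congr 3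
    apply hom_ext_prod
    · simp [-Functor.map_comp, ← G.map_comp]
      simp
    · apply hom_ext_prod
      · simp [-Functor.map_comp, ← G.map_comp]
        simp
      · simp [-Functor.map_comp, ← G.map_comp]
  lax_unit_left {X} a := by
    simp only [OrderHom.comp_coe, Function.comp_apply]
    conv_rhs => rw [← P.lax_unit_left a]
    rw [lax_map_left, map_map, map_map, mapFunctor_graph]
    simp only [graph_comp_graph, graph_tensor_graph]
    congr 3
    simp
  lax_unit_right {X} a := by
    simp only [OrderHom.comp_coe, Function.comp_apply]
    conv_rhs => rw [← P.lax_unit_right a]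
    rw [lax_map_right, map_map, map_map, mapFunctor_graph]
    simp only [graph_comp_graph, graph_tensor_graph]
    congr 3
    simp
  lax_braiding {X Y} a b := by
    simp only [OrderHom.comp_coe, Function.comp_apply]
    rw [← P.lax_braiding a b, map_map, map_map, mapFunctor_graph]
    simp only [graph_comp_graph]
    congr 3
    apply hom_ext_prod
    · simp [-Functor.map_comp, ← G.map_comp]
    · simp [-Functor.map_comp, ← G.map_comp]
  unit_rightAdjoint := ⟨fun _ => PUnit.unit, fun a b => by
    refine ⟨fun _ => ?_, fun _ => le_rfl⟩
    have h := (P.map (graph (PreservesTerminal.iso G).inv)).monotone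
      (P.le_truth (P.map (graph (PreservesTerminal.iso G).hom) a))
    rw [map_map, graph_comp_graph, Iso.hom_inv_id, P.map_id, truth,
      show terminal.from (⊤_ C) = 𝟙 _ from Subsingleton.elim _ _,
      show cograph (𝟙 (⊤_ C)) = graph (𝟙 _) from (graph_iso (Iso.refl _)).symm, P.map_id] at h
    exact h⟩
  lax_rightAdjoint X Y := by
    obtain ⟨l, hl⟩ := P.lax_rightAdjoint (G.obj X) (G.obj Y)
    refine ⟨fun a => l (P.map (graph (prodIso G X Y).inv) a), fun a b => ?_⟩
    rw [hl]
    constructor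
    · intro h
      have h' := (P.map (graph (prodIso G X Y).hom)).monotone h
      rwa [map_map, graph_comp_graph, Iso.inv_hom_id, P.map_id] at h'
    · intro h
      have h' := (P.map (graph (prodIso G X Y).inv)).monotone h
      simp only [OrderHom.comp_coe, Function.comp_apply] at h'
      rwa [map_map, graph_comp_graph, Iso.hom_inv_id, P.map_id] at h'

end AjaxFunctor

/-- A strict monoidal natural transformation between ajax po-functors. -/
structure AjaxHom (P : AjaxFunctor.{u, v, w} C) (Q : AjaxFunctor.{u, v, w'} C) where
  /-- the components -/
  app : ∀ X : C, P.obj X →o Q.obj X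
  natural : ∀ {X Y : C} (x : Reln X Y) (a : P.obj X), app Y (P.map x a) = Q.map x (app X a)
  unit : app (⊤_ C) P.unit = Q.unit
  lax : ∀ {X Y : C} (a : P.obj X) (b : P.obj Y),
    app (X ⨯ Y) (P.lax (a, b)) = Q.lax (app X a, app Y b)

namespace IntRel

variable {P : AjaxFunctor.{u', v', w} D} {Q : AjaxFunctor.{u, v, w'} C} (G : D ⥤ C)
  [IsRegularFunctor G]

theorem map_fst_prodIso {X Y : D} (t : Q.obj (G.obj (X ⨯ Y))) :
    Q.map (graph prod.fst) (Q.map (graph (prodIso G X Y).inv) t) =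
      Q.map (mapFunctor G (graph prod.fst)) t := by
  rw [Q.map_map, graph_comp_graph, prodIso_inv_fst, mapFunctor_graph]

theorem map_snd_prodIso {X Y : D} (t : Q.obj (G.obj (X ⨯ Y))) :
    Q.map (graph prod.snd) (Q.map (graph (prodIso G X Y).inv) t) =
      Q.map (mapFunctor G (graph prod.snd)) t := by
  rw [Q.map_map, graph_comp_graph, prodIso_inv_snd, mapFunctor_graph]

theorem map_relId_prodIso {X : D} (t : Q.obj (G.obj X)) :
    Q.map (graph (prodIso G X X).inv) (Q.map (mapFunctor G (graph (diag X))) t) = Q.relId t := by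
  rw [AjaxFunctor.relId, Q.map_map, mapFunctor_graph, graph_comp_graph]
  congr 3
  ext
  · simp [-Functor.map_comp, ← G.map_comp]
  · simp [-Functor.map_comp, ← G.map_comp]

theorem map_relComp_prodIso {X Y Z : D} (t : Q.obj (G.obj (X ⨯ Y))) (t' : Q.obj (G.obj (Y ⨯ Z))) :
    Q.map (graph (prodIso G X Z).inv) (Q.map (mapFunctor G (compDiagram X Y Z))
      (Q.map (graph (prodIso G (X ⨯ Y) (Y ⨯ Z)).hom) (Q.lax (t, t')))) =
    Q.relComp (Q.map (graph (prodIso G X Y).inv) t) (Q.map (graph (prodIso G Y Z).inv) t') := by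
  rw [AjaxFunctor.relComp, Q.lax_natural]
  simp only [Q.map_map]
  congr 2
  apply ext'
  intro A a c
  rw [graph_tensor_graph, show graph (prodIso G X Z).inv = cograph (prodIso G X Z).hom from
    graph_iso (prodIso G X Z).symm]
  simp only [holds_graph_comp, holds_comp_cograph, holds_mapFunctor_compDiagram, holds_compDiagram]
  simp

/-- The po-functor between internal relations induced by a regular functor `G` and a monoidal
natural transformation `α : P ⟶ Q ∘ G`: it sends `(X, φ)` to `(G X, α φ)`, and `θ` to `α θ`,
transported along `G (X × Y) ≅ G X × G Y`. -/
noncomputable def map (α : AjaxHom P (Q.comp G)) : IntRel P ⥤ IntRel Q where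
  obj X := ⟨G.obj X.ctx, α.app X.ctx X.pred⟩
  map {X Y} θ := ⟨Q.map (graph (prodIso G X.ctx Y.ctx).inv) (α.app _ θ.1),
    (map_fst_prodIso G _).trans_le
      ((α.natural (graph prod.fst) θ.1).ge.trans ((α.app _).monotone θ.2.1)),
    (map_snd_prodIso G _).trans_le
      ((α.natural (graph prod.snd) θ.1).ge.trans ((α.app _).monotone θ.2.2))⟩
  map_id X := Subtype.ext ((congrArg (Q.map (graph (prodIso G X.ctx X.ctx).inv))
    (α.natural (graph (diag X.ctx)) X.pred)).trans (map_relId_prodIso G (α.app _ X.pred)))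
  map_comp {X Y Z} θ θ' := Subtype.ext ((congrArg (Q.map (graph (prodIso G X.ctx Z.ctx).inv))
    ((α.natural (compDiagram X.ctx Y.ctx Z.ctx) (P.lax (θ.1, θ'.1))).trans
      (congrArg _ (α.lax θ.1 θ'.1)))).trans
    (map_relComp_prodIso G (α.app _ θ.1) (α.app _ θ'.1)))

/-- The po-functor of internal relations is monotone on morphisms. -/
theorem map_mono (α : AjaxHom P (Q.comp G)) {X Y : IntRel P} {θ θ' : X ⟶ Y} (h : θ ≤ θ') :
    (map G α).map θ ≤ (map G α).map θ' :=
  (Q.map _).monotone ((α.app _).monotone h)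

end IntRel

end ChangeOfBase

section Subobjects

open Reln

variable {C : Type u} [Category.{v} C] [Regular C]

theorem exists_common_cover {A B B' : C} (e : B ⟶ A) (e' : B' ⟶ A) [StrongEpi e] [StrongEpi e'] :
    ∃ (T : C) (p : T ⟶ B) (p' : T ⟶ B'), StrongEpi (p ≫ e) ∧ p ≫ e = p' ≫ e' := by
  have := strongEpi_pullback_fst e e'
  exact ⟨_, pullback.fst e e', pullback.snd e e', strongEpi_comp _ _, pullback.condition⟩

/-- The direct image of a subobject `φ ⊆ r` under a relation `x : r ⇸ s`: pull `φ` back to `x`, then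
take the image in `s`. -/
noncomputable def relImage {r s : C} (x : Reln r s) (φ : Subobject r) : Subobject s :=
  (Subobject.exists (x.arrow ≫ prod.snd)).obj ((Subobject.pullback (x.arrow ≫ prod.fst)).obj φ)

theorem relImage_factors {r s A : C} (x : Reln r s) (φ : Subobject r) (c : A ⟶ s) :
    (relImage x φ).Factors c ↔ ∃ (B : C) (e : B ⟶ A) (b : B ⟶ r), StrongEpi e ∧ φ.Factors b ∧
      x.Holds b (e ≫ c) := by
  rw [relImage, factors_exists]
  refine exists_congr fun B => exists_congr fun e => ?_
  constructor
  · rintro ⟨b, he, h1, h2⟩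
    rw [factors_pullback] at h1
    exact ⟨_, he, h1, h2 ▸ holds_arrow x b⟩
  · rintro ⟨b, he, h1, h2⟩
    obtain ⟨f, rfl, hf⟩ := h2.exists_arrow
    exact ⟨f, he, (factors_pullback _ _ _).2 h1, hf⟩

theorem relImage_graph_factors {r s A : C} (f : r ⟶ s) (φ : Subobject r) (c : A ⟶ s) :
    (relImage (graph f) φ).Factors c ↔ ∃ (B : C) (e : B ⟶ A) (b : B ⟶ r), StrongEpi e ∧
      φ.Factors b ∧ e ≫ c = b ≫ f := by
  simp only [relImage_factors, holds_graph]

theorem relImage_graph_iso_factors {r s A : C} (f : r ≅ s) (φ : Subobject r) (c : A ⟶ s) :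
    (relImage (graph f.hom) φ).Factors c ↔ φ.Factors (c ≫ f.inv) := by
  rw [relImage_graph_factors]
  constructor
  · rintro ⟨B, e, b, he, h1, h2⟩
    apply factors_of_cover _ e
    rw [← Category.assoc, h2]
    simpa using h1
  · intro h
    exact ⟨A, 𝟙 A, _, inferInstance, h, by simp⟩

/-- The external product of subobjects. -/
noncomputable def subProd {r s : C} (a : Subobject r) (b : Subobject s) : Subobject (r ⨯ s) :=
  (Subobject.pullback prod.fst).obj a ⊓ (Subobject.pullback prod.snd).obj b

theorem subProd_factors {r s A : C} (a : Subobject r) (b : Subobject s) (c : A ⟶ r ⨯ s) :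
    (subProd a b).Factors c ↔ a.Factors (c ≫ prod.fst) ∧ b.Factors (c ≫ prod.snd) := by
  rw [subProd, Subobject.inf_factors, factors_pullback, factors_pullback]

theorem relImage_comp {X Y Z : C} (x : Reln X Y) (y : Reln Y Z) (φ : Subobject X) :
    relImage (x.comp y) φ = relImage y (relImage x φ) := by
  apply ext_factors
  intro A c
  rw [relImage_factors, relImage_factors]
  constructor
  · rintro ⟨B, e, b, he, h1, h2⟩
    obtain ⟨B', e', b', he', h3, h4⟩ := (holds_comp ..).1 h2
    refine ⟨B', e' ≫ e, b', strongEpi_comp _ _, ?_, by simpa using h4⟩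
    exact (relImage_factors ..).2 ⟨B', 𝟙 _, e' ≫ b, inferInstance,
      Subobject.factors_of_factors_right _ h1, by simpa using h3⟩
  · rintro ⟨B, e, b, he, h1, h2⟩
    obtain ⟨B', e', b', he', h3, h4⟩ := (relImage_factors ..).1 h1
    refine ⟨B', e' ≫ e, b', strongEpi_comp _ _, h3, (holds_comp ..).2 ⟨B', 𝟙 _, e' ≫ b,
      inferInstance, by simpa using h4, by simpa using h2.precomp e'⟩⟩

theorem subProd_relImage {X Y X' Y' : C} (x : Reln X Y) (y : Reln X' Y') (a : Subobject X)
    (b : Subobject X') :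
    subProd (relImage x a) (relImage y b) = relImage (x.tensor y) (subProd a b) := by
  apply ext_factors
  intro A c
  rw [subProd_factors, relImage_factors, relImage_factors, relImage_factors]
  constructor
  · rintro ⟨⟨B, e, t, he, h1, h2⟩, ⟨B', e', t', he', h1', h2'⟩⟩
    obtain ⟨T, p, p', h, hp⟩ := exists_common_cover e e'
    refine ⟨T, p ≫ e, prod.lift (p ≫ t) (p' ≫ t'), h, ?_, ?_⟩
    · rw [subProd_factors, prod.lift_fst, prod.lift_snd]
      exact ⟨Subobject.factors_of_factors_right _ h1, Subobject.factors_of_factors_right _ h1'⟩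
    · rw [holds_tensor, prod.lift_fst, prod.lift_snd, Category.assoc]
      refine ⟨by simpa using h2.precomp p, ?_⟩
      simpa [← reassoc_of% hp] using h2'.precomp p'
  · rintro ⟨B, e, t, he, h1, h2⟩
    rw [subProd_factors] at h1
    rw [holds_tensor, Category.assoc, Category.assoc] at h2
    exact ⟨⟨B, e, _, he, h1.1, h2.1⟩, ⟨B, e, _, he, h1.2, h2.2⟩⟩

theorem relImage_mono_right {X Y : C} (x : Reln X Y) {a a' : Subobject X} (h : a ≤ a') :
    relImage x a ≤ relImage x a' :=
  ((Subobject.exists _).map ((Subobject.pullback _).map (homOfLE h))).le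

theorem relImage_mono_left {X Y : C} {x y : Reln X Y} (h : x ≤ y) (a : Subobject X) :
    relImage x a ≤ relImage y a := by
  rw [le_iff_factors]
  intro A c hc
  obtain ⟨B, e, b, he, h1, h2⟩ := (relImage_factors ..).1 hc
  exact (relImage_factors ..).2 ⟨B, e, b, he, h1, (le_iff _ _).1 h _ _ _ h2⟩

theorem subProd_mono {X Y : C} {a a' : Subobject X} {b b' : Subobject Y} (h : a ≤ a')
    (h' : b ≤ b') : subProd a b ≤ subProd a' b' :=
  inf_le_inf ((Subobject.pullback _).map (homOfLE h)).le
    ((Subobject.pullback _).map (homOfLE h')).le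

variable (C) in
/-- The ajax po-functor of subobjects of a regular category. -/
noncomputable abbrev sub : AjaxFunctor.{u, v, max u v} C where
  obj := Subobject
  map x := ⟨relImage x, fun _ _ h => relImage_mono_right x h⟩
  map_id a := ext_factors fun A c => by
    change (relImage (graph (Iso.refl _).hom) a).Factors c ↔ _
    rw [relImage_graph_iso_factors]; simp
  map_comp x y a := relImage_comp x y a
  map_mono h a := relImage_mono_left h a
  unit := ⊤
  lax := ⟨fun p => subProd p.1 p.2, fun _ _ h => subProd_mono h.1 h.2⟩
  lax_natural x y a b := subProd_relImage x y a b
  lax_assoc {X Y Z} a b c := ext_factors fun A t => by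
    change (relImage (graph (prod.associator X Y Z).hom) (subProd (subProd a b) c)).Factors t ↔
      (subProd a (subProd b c)).Factors t
    simp only [relImage_graph_iso_factors, subProd_factors]
    simp [and_assoc]
  lax_unit_left {X} a := ext_factors fun A t => by
    change (relImage (graph (prod.leftUnitor X).hom) (subProd ⊤ a)).Factors t ↔ _
    simp only [relImage_graph_iso_factors, subProd_factors]
    simp [Subobject.top_factors]
  lax_unit_right {X} a := ext_factors fun A t => by
    change (relImage (graph (prod.rightUnitor X).hom) (subProd a ⊤)).Factors t ↔ _
    simp only [relImage_graph_iso_factors, subProd_factors]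
    simp [Subobject.top_factors]
  lax_braiding {X Y} a b := ext_factors fun A t => by
    change (relImage (graph (prod.braiding X Y).hom) (subProd a b)).Factors t ↔
      (subProd b a).Factors t
    simp only [relImage_graph_iso_factors, subProd_factors]
    simp [and_comm]
  unit_rightAdjoint := ⟨fun _ => PUnit.unit, fun a b => ⟨fun _ => le_top, fun _ => le_rfl⟩⟩
  lax_rightAdjoint X Y := by
    refine ⟨fun a => (relImage (graph prod.fst) a, relImage (graph prod.snd) a), fun a p => ?_⟩
    change (_ ≤ p) ↔ a ≤ subProd p.1 p.2
    rw [Prod.le_def]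
    constructor
    · rintro ⟨h1, h2⟩
      rw [le_iff_factors] at h1 h2 ⊢
      intro A f hf
      rw [subProd_factors]
      exact ⟨h1 _ _ ((relImage_graph_factors ..).2 ⟨A, 𝟙 A, f, inferInstance, hf, by simp⟩),
        h2 _ _ ((relImage_graph_factors ..).2 ⟨A, 𝟙 A, f, inferInstance, hf, by simp⟩)⟩
    · intro h
      rw [le_iff_factors] at h
      constructor
      · rw [le_iff_factors]
        intro A f hf
        obtain ⟨B, e, b, he, h1, h2⟩ := (relImage_graph_factors ..).1 hf
        apply factors_of_cover _ e
        rw [h2]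
        exact ((subProd_factors ..).1 (h _ _ h1)).1
      · rw [le_iff_factors]
        intro A f hf
        obtain ⟨B, e, b, he, h1, h2⟩ := (relImage_graph_factors ..).1 hf
        apply factors_of_cover _ e
        rw [h2]
        exact ((subProd_factors ..).1 (h _ _ h1)).2

end Subobjects

/-- A context over a set of types `T`: a natural number `n`, a finite subset `supp ⊆ T` and a
function `τ : n → supp`. -/
structure FRg (T : Type u) where
  /-- the number of variables -/
  n : ℕ
  /-- the support, a finite subset of `T` -/
  supp : Set T
  supp_finite : supp.Finite
  /-- the typing of the variables -/
  τ : Fin n → T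
  τ_mem : ∀ i, τ i ∈ supp

namespace FRg

variable {T : Type u}

instance (Γ : FRg T) : Finite Γ.supp := Γ.supp_finite.to_subtype

/-- A morphism of contexts `Γ ⟶ Γ'`: a function `Γ'.n → Γ.n` over `T`, where moreover
`Γ'.supp ⊆ Γ.supp`. -/
@[ext] structure Hom (Γ Γ' : FRg T) where
  /-- the function on variables -/
  fn : Fin Γ'.n → Fin Γ.n
  τ_fn : ∀ i, Γ.τ (fn i) = Γ'.τ i
  supp_le : Γ'.supp ⊆ Γ.supp

/-- The free regular category on `T`: the opposite of the comma category of finite sets over finite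
subsets of `T`. -/
instance : Category.{0} (FRg T) where
  Hom := Hom
  id Γ := ⟨id, fun _ => rfl, subset_rfl⟩
  comp f g := ⟨f.fn ∘ g.fn, fun i => (f.τ_fn _).trans (g.τ_fn i), g.supp_le.trans f.supp_le⟩

@[ext] theorem hom_ext {Γ Γ' : FRg T} {f g : Γ ⟶ Γ'} (h : ∀ i, f.fn i = g.fn i) : f = g :=
  Hom.ext (funext h)

@[simp] theorem id_fn (Γ : FRg T) (i : Fin Γ.n) : Hom.fn (𝟙 Γ) i = i := rfl

@[simp] theorem comp_fn {Γ Γ' Γ'' : FRg T} (f : Γ ⟶ Γ') (g : Γ' ⟶ Γ'') (i : Fin Γ''.n) :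
    (f ≫ g).fn i = f.fn (g.fn i) := rfl

/-- A context whose variables are indexed by an arbitrary finite type. -/
noncomputable def of (ι : Type w) [Finite ι] (S : Set T) (hS : S.Finite) (τ : ι → T)
    (h : ∀ i, τ i ∈ S) : FRg T :=
  ⟨Nat.card ι, S, hS, fun i => τ ((Finite.equivFin ι).symm i), fun _ => h _⟩

section of

variable {ι : Type w} [Finite ι] {S : Set T} {hS : S.Finite} {τ : ι → T} {h : ∀ i, τ i ∈ S}

/-- A morphism out of a context with variables indexed by `ι`. -/
noncomputable def ofDesc {Γ : FRg T} (f : Fin Γ.n → ι) (hf : ∀ i, τ (f i) = Γ.τ i)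
    (hs : Γ.supp ⊆ S) : of ι S hS τ h ⟶ Γ :=
  ⟨fun i => Finite.equivFin ι (f i), fun i => by simp [of, hf], hs⟩

/-- A morphism into a context with variables indexed by `ι`. -/
noncomputable def ofLift {Γ : FRg T} (f : ι → Fin Γ.n) (hf : ∀ i, Γ.τ (f i) = τ i)
    (hs : S ⊆ Γ.supp) : Γ ⟶ of ι S hS τ h :=
  ⟨fun i => f ((Finite.equivFin ι).symm i), fun i => by simp [of, hf], hs⟩

theorem ofDesc_fn {Γ : FRg T} (f : Fin Γ.n → ι) (hf : ∀ i, τ (f i) = Γ.τ i)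
    (hs : Γ.supp ⊆ S) (i : Fin Γ.n) :
    (ofDesc f hf hs : of ι S hS τ h ⟶ Γ).fn i = Finite.equivFin ι (f i) := rfl

theorem ofLift_fn {Γ : FRg T} (f : ι → Fin Γ.n) (hf : ∀ i, Γ.τ (f i) = τ i)
    (hs : S ⊆ Γ.supp) (i : ι) :
    (ofLift f hf hs : Γ ⟶ of ι S hS τ h).fn (Finite.equivFin ι i) = f i := by simp [ofLift]

end of

/-- The terminal context. -/
def empty : FRg T := ⟨0, ∅, Set.finite_empty, Fin.elim0, fun i => i.elim0⟩

/-- The empty context is terminal. -/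
def emptyIsTerminal : IsTerminal (empty : FRg T) :=
  IsTerminal.ofUniqueHom (fun _ => ⟨Fin.elim0, fun i => i.elim0, Set.empty_subset _⟩)
    (fun _ _ => hom_ext fun i => i.elim0)

section Pullback

variable {X Y Z : FRg T} (f : X ⟶ Z) (g : Y ⟶ Z)

/-- The relation that generates the pushout of the functions on variables. -/
def gluing (p q : Fin X.n ⊕ Fin Y.n) : Prop :=
  ∃ z, p = Sum.inl (f.fn z) ∧ q = Sum.inr (g.fn z)

/-- The pullback of contexts. -/
noncomputable def pb : FRg T :=
  of (Quot (gluing f g)) (X.supp ∪ Y.supp) (X.supp_finite.union Y.supp_finite)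
    (Quot.lift (Sum.elim X.τ Y.τ) (by
      rintro _ _ ⟨z, rfl, rfl⟩
      exact (f.τ_fn z).trans (g.τ_fn z).symm))
    (by
      rintro ⟨i | i⟩
      · exact Or.inl (X.τ_mem i)
      · exact Or.inr (Y.τ_mem i))

/-- The first projection. -/
noncomputable def pbFst : pb f g ⟶ X :=
  ofDesc (fun i => Quot.mk _ (Sum.inl i)) (fun _ => rfl) Set.subset_union_left

/-- The second projection. -/
noncomputable def pbSnd : pb f g ⟶ Y :=
  ofDesc (fun i => Quot.mk _ (Sum.inr i)) (fun _ => rfl) Set.subset_union_right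

theorem pb_w : pbFst f g ≫ f = pbSnd f g ≫ g :=
  hom_ext fun i => congrArg (Finite.equivFin _) (Quot.sound ⟨i, rfl, rfl⟩)

theorem pb_ind {p : Fin (pb f g).n → Prop} (h1 : ∀ i, p ((pbFst f g).fn i))
    (h2 : ∀ i, p ((pbSnd f g).fn i)) (i) : p i := by
  obtain ⟨⟨j | j⟩, rfl⟩ := (Finite.equivFin (Quot (gluing f g))).surjective i
  · exact h1 j
  · exact h2 j

theorem pb_desc {α : Type w} (a : Fin X.n → α) (b : Fin Y.n → α)
    (h : ∀ z, a (f.fn z) = b (g.fn z)) : ∃ c : Fin (pb f g).n → α,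
      (∀ i, c ((pbFst f g).fn i) = a i) ∧ (∀ i, c ((pbSnd f g).fn i) = b i) := by
  refine ⟨fun i => Quot.lift (Sum.elim a b) ?_ ((Finite.equivFin (Quot (gluing f g))).symm i),
    fun i => ?_, fun i => ?_⟩
  · rintro _ _ ⟨z, rfl, rfl⟩
    exact h z
  · exact congrArg (Quot.lift (Sum.elim a b) _)
      ((Finite.equivFin (Quot (gluing f g))).symm_apply_apply _)
  · exact congrArg (Quot.lift (Sum.elim a b) _)
      ((Finite.equivFin (Quot (gluing f g))).symm_apply_apply _)

end Pullback

theorem isPullback_of {P X Y Z : FRg T} {p : P ⟶ X} {q : P ⟶ Y} {f : X ⟶ Z} {g : Y ⟶ Z}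
    (w : p ≫ f = q ≫ g) (hs : P.supp ⊆ X.supp ∪ Y.supp)
    (ind : ∀ (φ : Fin P.n → Prop), (∀ i, φ (p.fn i)) → (∀ i, φ (q.fn i)) → ∀ i, φ i)
    (desc : ∀ (m : ℕ) (a : Fin X.n → Fin m) (b : Fin Y.n → Fin m),
      (∀ z, a (f.fn z) = b (g.fn z)) →
      ∃ c : Fin P.n → Fin m, (∀ i, c (p.fn i) = a i) ∧ (∀ i, c (q.fn i) = b i)) :
    IsPullback p q f g := by
  have key : ∀ {Q : FRg T} (a : Q ⟶ X) (b : Q ⟶ Y), a ≫ f = b ≫ g →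
      ∃ c : Q ⟶ P, c ≫ p = a ∧ c ≫ q = b := by
    intro Q a b h
    obtain ⟨c, h1, h2⟩ := desc _ a.fn b.fn (fun z => congrFun (congrArg Hom.fn h) z)
    refine ⟨⟨c, ind _ ?_ ?_, hs.trans (Set.union_subset a.supp_le b.supp_le)⟩, hom_ext h1,
      hom_ext h2⟩
    · intro i
      rw [h1, a.τ_fn, p.τ_fn]
    · intro i
      rw [h2, b.τ_fn, q.τ_fn]
  choose c h1 h2 using @key
  refine ⟨⟨w⟩, ⟨PullbackCone.IsLimit.mk w (fun s => c s.fst s.snd s.condition)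
    (fun s => h1 _ _ _) (fun s => h2 _ _ _) (fun s m hm1 hm2 => ?_)⟩⟩
  refine hom_ext (ind _ (fun i => ?_) (fun i => ?_))
  · have := congrFun (congrArg Hom.fn (hm1.trans (h1 s.fst s.snd s.condition).symm)) i
    exact this
  · have := congrFun (congrArg Hom.fn (hm2.trans (h2 s.fst s.snd s.condition).symm)) i
    exact this

theorem isPullback_pb {X Y Z : FRg T} (f : X ⟶ Z) (g : Y ⟶ Z) :
    IsPullback (pbFst f g) (pbSnd f g) f g :=
  isPullback_of (pb_w f g) subset_rfl (fun _ h1 h2 => pb_ind f g h1 h2)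
    (fun _ a b h => pb_desc f g a b h)

instance : HasFiniteLimits (FRg T) := by
  have : HasTerminal (FRg T) := emptyIsTerminal.hasTerminal
  have : HasPullbacks (FRg T) := by
    have : ∀ {X Y Z : FRg T} {f : X ⟶ Z} {g : Y ⟶ Z}, HasLimit (cospan f g) := fun {_ _ _ f g} =>
      (isPullback_pb f g).hasPullback
    exact hasPullbacks_of_hasLimit_cospan _
  exact hasFiniteLimits_of_hasTerminal_and_pullbacks

section Coequalizer

variable {X Z : FRg T} (g₁ g₂ : Z ⟶ X)

/-- The coequalizer of two morphisms of contexts. -/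
noncomputable def coeq : FRg T :=
  of {i : Fin X.n // g₁.fn i = g₂.fn i} X.supp X.supp_finite (fun i => X.τ i.1) (fun _ => X.τ_mem _)

/-- The projection to the coequalizer. -/
noncomputable def coeqπ : X ⟶ coeq g₁ g₂ := ofLift (fun i => i.1) (fun _ => rfl) subset_rfl

theorem coeqπ_injective : Function.Injective (coeqπ g₁ g₂).fn := by
  intro i j h
  exact (Finite.equivFin {i : Fin X.n // g₁.fn i = g₂.fn i}).symm.injective (Subtype.ext h)

theorem coeq_w : g₁ ≫ coeqπ g₁ g₂ = g₂ ≫ coeqπ g₁ g₂ :=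
  hom_ext fun i => ((Finite.equivFin {i : Fin X.n // g₁.fn i = g₂.fn i}).symm i).2

theorem coeq_desc {V : FRg T} (h : X ⟶ V) (w : g₁ ≫ h = g₂ ≫ h) :
    ∃ d : coeq g₁ g₂ ⟶ V, coeqπ g₁ g₂ ≫ d = h := by
  refine ⟨ofDesc (fun v => ⟨h.fn v, congrFun (congrArg Hom.fn w) v⟩) h.τ_fn h.supp_le, ?_⟩
  refine hom_ext fun i => ?_
  exact congrArg Subtype.val
    ((Finite.equivFin {i : Fin X.n // g₁.fn i = g₂.fn i}).symm_apply_apply _)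

end Coequalizer

theorem epi_of_injective {X Y : FRg T} (e : X ⟶ Y) (he : Function.Injective e.fn) : Epi e :=
  ⟨fun _ _ h => hom_ext fun i => he (congrFun (congrArg Hom.fn h) i)⟩

theorem hasCoequalizer {X Z : FRg T} (g₁ g₂ : Z ⟶ X) : HasCoequalizer g₁ g₂ := by
  have := epi_of_injective _ (coeqπ_injective g₁ g₂)
  choose d hd using @coeq_desc T X Z g₁ g₂
  exact ⟨⟨⟨Cofork.ofπ _ (coeq_w g₁ g₂), Cofork.IsColimit.mk _ (fun s => d s.π s.condition)
    (fun _ => hd _ _) (fun s m hm => by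
      rw [← cancel_epi (coeqπ g₁ g₂), hd]
      exact hm)⟩⟩⟩

/-- A morphism of contexts is a regular epimorphism if and only if its function on variables is
injective and the supports agree. -/
theorem isRegularEpi_iff {X Y : FRg T} (e : X ⟶ Y) :
    IsRegularEpi e ↔ Function.Injective e.fn ∧ X.supp ⊆ Y.supp := by
  constructor
  · rintro ⟨⟨r⟩⟩
    have : Epi e := Cofork.IsColimit.epi r.isColimit
    obtain ⟨d', hd'⟩ := coeq_desc r.left r.right e r.w
    obtain ⟨d, hd⟩ := Cofork.IsColimit.desc' r.isColimit _ (coeq_w r.left r.right)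
    simp only [Cofork.π_ofπ] at hd
    have h : d ≫ d' = 𝟙 Y := by
      rw [← cancel_epi e, ← Category.assoc, hd, hd', Category.comp_id]
    refine ⟨?_, d.supp_le⟩
    have h1 : Function.Injective d'.fn := fun i j hij => by
      have := congrArg d.fn hij
      rw [← comp_fn, ← comp_fn, h] at this
      exact this
    rw [← hd']
    exact (coeqπ_injective _ _).comp h1
  · rintro ⟨he, hs⟩
    have := epi_of_injective e he
    classical
    let W : FRg T := of (Fin X.n × Bool) X.supp X.supp_finite (fun p => X.τ p.1)
      (fun p => X.τ_mem _)
    let l : W ⟶ X := ofDesc (fun i => (i, true)) (fun _ => rfl) subset_rfl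
    let r : W ⟶ X := ofDesc (fun i => (i, decide (i ∈ Set.range e.fn))) (fun _ => rfl) subset_rfl
    have w : l ≫ e = r ≫ e := hom_ext fun i =>
      congrArg (Finite.equivFin (Fin X.n × Bool)) (by simp)
    have key : ∀ {V : FRg T} (h : X ⟶ V), l ≫ h = r ≫ h → ∃ d : Y ⟶ V, e ≫ d = h := by
      intro V h hw
      have hr : ∀ v, ∃ y, e.fn y = h.fn v := by
        intro v
        have := congrFun (congrArg Hom.fn hw) v
        rw [comp_fn, comp_fn, ofDesc_fn, ofDesc_fn] at this
        have := congrArg Prod.snd ((Finite.equivFin (Fin X.n × Bool)).injective this)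
        simpa using this
      choose d hd using hr
      refine ⟨⟨d, fun v => ?_, h.supp_le.trans hs⟩, hom_ext hd⟩
      rw [← e.τ_fn, hd, h.τ_fn]
    choose d hd using @key
    exact ⟨⟨⟨W, l, r, w, Cofork.IsColimit.mk _ (fun s => d s.π s.condition)
      (fun s => hd _ _) (fun s m hm => by
        rw [← cancel_epi e, hd]
        exact hm)⟩⟩⟩

theorem isRegularEpi_of_isPullback {P X Y Z : FRg T} {p : P ⟶ X} {q : P ⟶ Y} {f : X ⟶ Z}
    {g : Y ⟶ Z} (sq : IsPullback p q f g) (hf : IsRegularEpi f) : IsRegularEpi q := by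
  rw [isRegularEpi_iff] at hf ⊢
  obtain ⟨hf, hs⟩ := hf
  classical
  let Q : FRg T := of (Fin Y.n ⊕ Fin X.n) Y.supp Y.supp_finite
    (Sum.elim Y.τ X.τ) (by
      rintro (i | i)
      · exact Y.τ_mem i
      · exact g.supp_le (hs (X.τ_mem i)))
  let a : Q ⟶ Y := ofDesc Sum.inl (fun _ => rfl) subset_rfl
  let b : Q ⟶ X := ofDesc (fun x => if h : ∃ z, f.fn z = x then Sum.inl (g.fn h.choose)
    else Sum.inr x) (fun x => by
      split_ifs with h
      · conv_rhs => rw [← h.choose_spec, f.τ_fn]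
        exact g.τ_fn _
      · rfl) (hs.trans g.supp_le)
  have w : b ≫ f = a ≫ g := hom_ext fun z => by
    have h : ∃ z', f.fn z' = f.fn z := ⟨z, rfl⟩
    simp only [comp_fn, a, b, ofDesc_fn]
    rw [dif_pos h, hf h.choose_spec]
    rfl
  obtain ⟨u, -, hu⟩ := sq.exists_lift b a w
  constructor
  · intro i j hij
    have h := congrArg u.fn hij
    rw [← comp_fn, ← comp_fn, hu] at h
    exact Sum.inl_injective ((Finite.equivFin (Fin Y.n ⊕ Fin X.n)).injective h)
  · exact u.supp_le

instance : Regular (FRg T) where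
  hasCoequalizer_of_isKernelPair _ := hasCoequalizer _ _
  regularEpiIsStableUnderBaseChange := ⟨fun sq h =>
    isRegularEpi_of_isPullback sq h⟩

section Map

variable {T' : Type u'} (F : T → T')

/-- The functor `FRg F`, which relabels contexts along `F : T → T'`. -/
abbrev map : FRg T ⥤ FRg T' where
  obj Γ := ⟨Γ.n, F '' Γ.supp, Γ.supp_finite.image F, fun i => F (Γ.τ i),
    fun i => Set.mem_image_of_mem F (Γ.τ_mem i)⟩
  map f := ⟨f.fn, fun i => congrArg F (f.τ_fn i), Set.image_mono f.supp_le⟩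

end Map

end FRg

theorem isRegularFunctor_of {C : Type u} [Category.{v} C] [Regular C] {D : Type u'}
    [Category.{v'} D] [Regular D] (G : D ⥤ C) {t : D} (ht : IsTerminal t)
    (ht' : IsTerminal (G.obj t))
    (h : ∀ {X Y Z : D} (f : X ⟶ Z) (g : Y ⟶ Z), ∃ (P : D) (p : P ⟶ X) (q : P ⟶ Y),
      IsPullback p q f g ∧ IsPullback (G.map p) (G.map q) (G.map f) (G.map g))
    (he : ∀ {X Y : D} (f : X ⟶ Y), IsRegularEpi f → IsRegularEpi (G.map f)) :
    IsRegularFunctor G := by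
  have : PreservesLimit (Functor.empty.{0} D) G := by
    exact preservesLimit_of_preserves_limit_cone ht ((isLimitMapConeEmptyConeEquiv G t).symm ht')
  have : PreservesLimitsOfShape (Discrete PEmpty.{1}) G :=
    preservesLimitsOfShape_pempty_of_preservesTerminal G
  have : PreservesLimitsOfShape WalkingCospan G := by
    have h2 : ∀ {X Y Z : D} (f : X ⟶ Z) (g : Y ⟶ Z), PreservesLimit (cospan f g) G := by
      intro X Y Z f g
      obtain ⟨P, p, q, h1, h2⟩ := h f g
      exact preservesLimit_of_preserves_limit_cone h1.isLimit
        ((isLimitMapConePullbackConeEquiv G h1.w).symm h2.isLimit)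
    refine ⟨fun {K} => ?_⟩
    exact preservesLimit_of_iso_diagram G (diagramIsoCospan K).symm
  have := preservesFiniteLimits_of_preservesTerminal_and_pullbacks G
  exact ⟨fun f => he f⟩

instance {T : Type u} {T' : Type u'} (F : T → T') : IsRegularFunctor (FRg.map F) :=
  isRegularFunctor_of _ FRg.emptyIsTerminal
    (IsTerminal.ofUniqueHom (fun _ => ⟨Fin.elim0, fun i => i.elim0, by
      rintro _ ⟨_, ⟨⟩, _⟩⟩) (fun _ _ => FRg.hom_ext fun i => i.elim0))
    (fun f g => ⟨_, _, _, FRg.isPullback_pb f g, FRg.isPullback_of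
      (by rw [← Functor.map_comp, FRg.pb_w, Functor.map_comp]) (Set.image_union ..).subset
      (fun _ h1 h2 => FRg.pb_ind f g h1 h2) (fun _ a b h => FRg.pb_desc f g a b h)⟩)
    (fun f hf => by
      rw [FRg.isRegularEpi_iff] at hf ⊢
      exact ⟨hf.1, Set.image_mono hf.2⟩)

section Interpretation

variable {C : Type u} [Category.{v} C] [Regular C]

/-- The support of an object `r`: the image of the morphism from `r` to the terminal object. -/
noncomputable def Supp (r : C) : C := image (terminal.from r)

/-- The projection of an object to its support. -/
noncomputable def toSupp (r : C) : r ⟶ Supp r := factorThruImage (terminal.from r)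

instance (r : C) : StrongEpi (toSupp r) := inferInstanceAs (StrongEpi (factorThruImage _))

instance (r A : C) : Subsingleton (A ⟶ Supp r) :=
  ⟨fun _ _ => (cancel_mono (image.ι (terminal.from r))).1 (Subsingleton.elim _ _)⟩

theorem nonempty_hom_supp_iff {r A : C} :
    Nonempty (A ⟶ Supp r) ↔ ∃ (B : C) (e : B ⟶ A), StrongEpi e ∧ Nonempty (B ⟶ r) := by
  constructor
  · rintro ⟨f⟩
    exact ⟨_, pullback.fst f (toSupp r), strongEpi_pullback_fst _ _, ⟨pullback.snd _ _⟩⟩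
  · rintro ⟨B, e, he, ⟨b⟩⟩
    have : (Subobject.mk (image.ι (terminal.from r))).Factors (e ≫ terminal.from A) := by
      rw [factors_mk_iff]
      exact ⟨b ≫ toSupp r, Subsingleton.elim _ _⟩
    obtain ⟨g, -⟩ := (factors_mk_iff _ _).1 (factors_of_cover _ e _ this)
    exact ⟨g⟩

namespace FRg

/-- The interpretation of a context `Γ` of objects of a regular category: the product of its
variables and of the supports of the elements of its support. -/
noncomputable abbrev quoteObj (Γ : FRg C) : C :=
  (∏ᶜ fun i : Fin Γ.n => Γ.τ i) ⨯ (∏ᶜ fun s : Γ.supp => Supp s.1)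

/-- The projection to a variable. -/
noncomputable def quoteπ (Γ : FRg C) (i : Fin Γ.n) : quoteObj Γ ⟶ Γ.τ i :=
  prod.fst ≫ Pi.π (fun i : Fin Γ.n => Γ.τ i) i

/-- The projection to a support. -/
noncomputable def quoteσ (Γ : FRg C) (s : Γ.supp) : quoteObj Γ ⟶ Supp s.1 :=
  prod.snd ≫ Pi.π (fun s : Γ.supp => Supp s.1) s

/-- The morphism into the interpretation of a context that is given by its components. -/
noncomputable def quoteLift (Γ : FRg C) {A : C} (a : ∀ i, A ⟶ Γ.τ i)
    (b : ∀ s : Γ.supp, A ⟶ Supp s.1) : A ⟶ quoteObj Γ :=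
  prod.lift (Pi.lift a) (Pi.lift b)

@[simp] theorem quoteLift_π (Γ : FRg C) {A : C} (a : ∀ i, A ⟶ Γ.τ i)
    (b : ∀ s : Γ.supp, A ⟶ Supp s.1) (i) : quoteLift Γ a b ≫ quoteπ Γ i = a i := by
  simp only [quoteLift, quoteπ]
  rw [prod.lift_fst_assoc, Pi.lift_π]

theorem quote_ext {Γ : FRg C} {A : C} {f g : A ⟶ quoteObj Γ}
    (h : ∀ i, f ≫ quoteπ Γ i = g ≫ quoteπ Γ i) : f = g := by
  apply prod.hom_ext
  · apply Pi.hom_ext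
    intro i
    simpa only [quoteπ, Category.assoc] using h i
  · apply Pi.hom_ext
    intro i
    exact Subsingleton.elim _ _

/-- The interpretation functor, which sends a morphism of contexts to the evident morphism of
projections and diagonals. -/
noncomputable abbrev quote (C : Type u) [Category.{v} C] [Regular C] : FRg C ⥤ C where
  obj := quoteObj
  map {Γ Γ'} f := quoteLift Γ' (fun i => quoteπ Γ (f.fn i) ≫ eqToHom (f.τ_fn i))
    (fun s => quoteσ Γ ⟨s.1, f.supp_le s.2⟩)
  map_id Γ := quote_ext fun i => by rw [quoteLift_π]; simp
  map_comp {Γ Γ' Γ''} f g := quote_ext fun i => by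
    simp only [quoteLift_π, Category.assoc, comp_fn]
    rw [← Category.assoc (quoteLift _ _ _), quoteLift_π, Category.assoc, eqToHom_trans]

/-- The projection of the interpretation of a context to one of its variables. -/
noncomputable def varπ (Γ : FRg C) (i : Fin Γ.n) : (quote C).obj Γ ⟶ Γ.τ i := quoteπ Γ i

/-- The projection of the interpretation of a context to one of its supports. -/
noncomputable def suppπ (Γ : FRg C) (s : Γ.supp) : (quote C).obj Γ ⟶ Supp s.1 := quoteσ Γ s

/-- The morphism into the interpretation of a context that is given by its components. -/
noncomputable def liftObj (Γ : FRg C) {A : C} (a : ∀ i, A ⟶ Γ.τ i)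
    (b : ∀ s : Γ.supp, A ⟶ Supp s.1) : A ⟶ (quote C).obj Γ := quoteLift Γ a b

@[simp] theorem liftObj_varπ (Γ : FRg C) {A : C} (a : ∀ i, A ⟶ Γ.τ i)
    (b : ∀ s : Γ.supp, A ⟶ Supp s.1) (i) : liftObj Γ a b ≫ varπ Γ i = a i := quoteLift_π ..

@[simp] theorem map_varπ {Γ Γ' : FRg C} (f : Γ ⟶ Γ') (i) :
    (quote C).map f ≫ varπ Γ' i = varπ Γ (f.fn i) ≫ eqToHom (f.τ_fn i) := quoteLift_π ..

theorem obj_ext {Γ : FRg C} {A : C} {f g : A ⟶ (quote C).obj Γ}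
    (h : ∀ i, f ≫ varπ Γ i = g ≫ varπ Γ i) : f = g := quote_ext h

/-- The components of a generalized element of the interpretation of a context. -/
noncomputable def elt {Γ : FRg C} {A : C} (a : A ⟶ (quote C).obj Γ) (i : Fin Γ.n) : Σ t : C, A ⟶ t :=
  ⟨Γ.τ i, a ≫ varπ Γ i⟩

theorem sigma_eqToHom {A s t : C} (f : A ⟶ s) (h : s = t) :
    (⟨t, f ≫ eqToHom h⟩ : Σ t : C, A ⟶ t) = ⟨s, f⟩ := by
  subst h; simp

theorem elt_injective {Γ : FRg C} {A : C} {a b : A ⟶ (quote C).obj Γ} (h : ∀ i, elt a i = elt b i) :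
    a = b :=
  obj_ext fun i => by simpa [elt] using h i

theorem elt_map {Γ Γ' : FRg C} (f : Γ ⟶ Γ') {A : C} (a : A ⟶ (quote C).obj Γ) (i : Fin Γ'.n) :
    elt (a ≫ (quote C).map f) i = elt a (f.fn i) := by
  have : (a ≫ (quote C).map f) ≫ varπ Γ' i = (a ≫ varπ Γ (f.fn i)) ≫ eqToHom (f.τ_fn i) := by
    rw [Category.assoc, Category.assoc, map_varπ]
  rw [elt, elt, this, sigma_eqToHom]

theorem exists_elt (Γ : FRg C) {A : C} (e : Fin Γ.n → Σ t : C, A ⟶ t) (he : ∀ i, (e i).1 = Γ.τ i)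
    (hs : ∀ s ∈ Γ.supp, Nonempty (A ⟶ Supp s)) : ∃ a : A ⟶ (quote C).obj Γ, ∀ i, elt a i = e i := by
  refine ⟨liftObj Γ (fun i => (e i).2 ≫ eqToHom (he i)) (fun s => (hs s.1 s.2).some), fun i => ?_⟩
  rw [elt, liftObj_varπ, sigma_eqToHom]

theorem supp_of_elt {Γ : FRg C} {A : C} (a : A ⟶ (quote C).obj Γ) {s : C} (hs : s ∈ Γ.supp) :
    Nonempty (A ⟶ Supp s) := ⟨a ≫ suppπ Γ ⟨s, hs⟩⟩

theorem elt_precomp {Γ : FRg C} {A B : C} (g : B ⟶ A) (a : A ⟶ (quote C).obj Γ) (i : Fin Γ.n) :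
    elt (g ≫ a) i = ⟨(elt a i).1, g ≫ (elt a i).2⟩ := by
  simp [elt]

theorem isPullback_quote_pb {X Y Z : FRg C} (f : X ⟶ Z) (g : Y ⟶ Z) :
    IsPullback ((quote C).map (pbFst f g)) ((quote C).map (pbSnd f g)) ((quote C).map f)
      ((quote C).map g) := by
  have w : (quote C).map (pbFst f g) ≫ (quote C).map f =
      (quote C).map (pbSnd f g) ≫ (quote C).map g := by
    rw [← Functor.map_comp, pb_w, Functor.map_comp]
  have key : ∀ {A : C} (a : A ⟶ (quote C).obj X) (b : A ⟶ (quote C).obj Y),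
      a ≫ (quote C).map f = b ≫ (quote C).map g → ∃ c : A ⟶ ((quote C).obj (pb f g)),
        c ≫ (quote C).map (pbFst f g) = a ∧ c ≫ (quote C).map (pbSnd f g) = b := by
    intro A a b h
    obtain ⟨e, he1, he2⟩ := pb_desc f g (elt a) (elt b) (fun z => by
      rw [← elt_map, ← elt_map, h])
    obtain ⟨c, hc⟩ := exists_elt (pb f g) e (pb_ind f g
      (fun i => by rw [he1, (pbFst f g).τ_fn]; rfl) (fun i => by rw [he2, (pbSnd f g).τ_fn]; rfl))
      (by
        rintro s (hs | hs)
        · exact supp_of_elt a hs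
        · exact supp_of_elt b hs)
    refine ⟨c, elt_injective fun i => ?_, elt_injective fun i => ?_⟩
    · rw [elt_map, hc, he1]
    · rw [elt_map, hc, he2]
  choose c h1 h2 using @key
  refine ⟨⟨w⟩, ⟨PullbackCone.IsLimit.mk w (fun s => c s.fst s.snd s.condition)
    (fun s => h1 _ _ _) (fun s => h2 _ _ _) (fun s m hm1 hm2 => ?_)⟩⟩
  refine elt_injective (pb_ind f g (fun i => ?_) (fun i => ?_))
  · rw [← elt_map, ← elt_map, h1]
    exact congrArg (fun a => elt a i) hm1
  · rw [← elt_map, ← elt_map, h2]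
    exact congrArg (fun a => elt a i) hm2

theorem exists_cover_family {A : C} : ∀ (n : ℕ) (τ : Fin n → C)
    (_ : ∀ i, Nonempty (A ⟶ Supp (τ i))), ∃ (B : C) (e : B ⟶ A), StrongEpi e ∧
      ∀ i, Nonempty (B ⟶ τ i)
  | 0, _, _ => ⟨A, 𝟙 A, inferInstance, fun i => i.elim0⟩
  | n + 1, τ, h => by
    obtain ⟨B, e, he, hb⟩ := exists_cover_family n (fun i => τ i.succ) (fun i => h i.succ)
    obtain ⟨B', e', he', hb'⟩ := nonempty_hom_supp_iff.1 (h 0)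
    obtain ⟨W, p, p', hp, hpp⟩ := exists_common_cover e e'
    refine ⟨W, p ≫ e, hp, Fin.cases ?_ fun i => ?_⟩
    · exact hb'.map (p' ≫ ·)
    · exact (hb i).map (p ≫ ·)

theorem quote_strongEpi {X Y : FRg C} (f : X ⟶ Y) (hf : IsRegularEpi f) :
    StrongEpi ((quote C).map f) := by
  obtain ⟨hf, hs⟩ := (isRegularEpi_iff f).1 hf
  obtain ⟨B, e, he, hb⟩ := exists_cover_family X.n X.τ
    (fun i => supp_of_elt (𝟙 ((quote C).obj Y)) (hs (X.τ_mem i)))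
  classical
  obtain ⟨x, hx⟩ := exists_elt X (A := B)
    (fun i => if h : ∃ j, f.fn j = i then elt e h.choose else ⟨X.τ i, (hb i).some⟩)
    (fun i => by
      split_ifs with h
      · conv_rhs => rw [← h.choose_spec, f.τ_fn]
        rfl
      · rfl)
    (fun s h => (supp_of_elt (𝟙 ((quote C).obj Y)) (hs h)).map (e ≫ ·))
  have : x ≫ (quote C).map f = e := elt_injective fun j => by
    have h : ∃ j', f.fn j' = f.fn j := ⟨j, rfl⟩
    rw [elt_map, hx, dif_pos h, hf h.choose_spec]
  rw [← this] at he
  exact strongEpi_of_strongEpi x _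

instance : IsRegularFunctor (quote C) :=
  isRegularFunctor_of _ emptyIsTerminal
    (IsTerminal.ofUniqueHom (fun _ => liftObj _ (fun i => i.elim0) (fun s => s.2.elim))
      (fun _ _ => obj_ext fun i => i.elim0))
    (fun f g => ⟨_, _, _, isPullback_pb f g, isPullback_quote_pb f g⟩)
    (fun f hf => by
      have := quote_strongEpi f hf
      exact isRegularEpi_of_strongEpi _)

end FRg

end Interpretation

section MorphismsOfAjaxFunctors

open Reln

variable {C : Type u} [Category.{v} C] [Regular C]
variable {D : Type u'} [Category.{v'} D] [Regular D]

namespace AjaxHom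

/-- The composite of monoidal natural transformations. -/
def comp {P : AjaxFunctor.{u, v, w} C} {Q : AjaxFunctor.{u, v, w'} C}
    {S : AjaxFunctor.{u, v, w''} C} (α : AjaxHom P Q) (β : AjaxHom Q S) : AjaxHom P S where
  app X := (β.app X).comp (α.app X)
  natural x a := (congrArg (β.app _) (α.natural x a)).trans (β.natural x _)
  unit := (congrArg (β.app _) α.unit).trans β.unit
  lax a b := (congrArg (β.app _) (α.lax a b)).trans (β.lax _ _)

/-- The restriction of a monoidal natural transformation along a regular functor. -/
noncomputable def whisker {P : AjaxFunctor.{u, v, w} C} {Q : AjaxFunctor.{u, v, w'} C}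
    (α : AjaxHom P Q) (G : D ⥤ C) [IsRegularFunctor G] : AjaxHom (P.comp G) (Q.comp G) where
  app X := α.app (G.obj X)
  natural x a := α.natural (mapFunctor G x) a
  unit := (α.natural _ _).trans (congrArg _ α.unit)
  lax a b := (α.natural _ _).trans (congrArg _ (α.lax a b))

end AjaxHom

instance isRegularFunctor_comp {E : Type w} [Category.{w'} E] [Regular E] (G : D ⥤ C)
    [IsRegularFunctor G] (H : C ⥤ E) [IsRegularFunctor H] : IsRegularFunctor (G ⋙ H) where
  toPreservesFiniteLimits := comp_preservesFiniteLimits G H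
  map_regularEpi f hf := IsRegularFunctor.map_regularEpi (G := H) _
    (IsRegularFunctor.map_regularEpi (G := G) f hf)

section

variable {E : Type w} [Category.{w'} E] [Regular E] (G : D ⥤ C) [IsRegularFunctor G] (H : C ⥤ E)
  [IsRegularFunctor H]

theorem mapFunctor_mapFunctor {X Y : D} (x : Reln X Y) :
    mapFunctor H (mapFunctor G x) = mapFunctor (G ⋙ H) x := by
  apply ext'
  intro A a b
  constructor
  · intro h
    obtain ⟨f, rfl, rfl⟩ := (holds_mapFunctor ..).1 h
    obtain ⟨g, h1, h2⟩ := (holds_mapFunctor ..).1 (holds_arrow (mapFunctor G x) (𝟙 _))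
    simp only [Category.id_comp] at h1 h2
    rw [holds_mapFunctor]
    refine ⟨f ≫ H.map g, ?_, ?_⟩
    · rw [Category.assoc, ← h1, H.map_comp]; rfl
    · rw [Category.assoc, ← h2, H.map_comp]; rfl
  · intro h
    obtain ⟨f, rfl, rfl⟩ := (holds_mapFunctor ..).1 h
    have := (((holds_arrow x (𝟙 _)).mapFunctor G).mapFunctor H).precomp f
    simp only [Category.id_comp] at this
    exact this

theorem prodIso_comp (X Y : D) : (prodIso H (G.obj X) (G.obj Y)).hom ≫ H.map (prodIso G X Y).hom =
    (prodIso (G ⋙ H) X Y).hom := by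
  apply hom_ext_prod (G ⋙ H)
  · rw [prodIso_hom_fst, Functor.comp_map, Category.assoc, ← H.map_comp, prodIso_hom_fst]
    exact prodIso_hom_fst ..
  · rw [prodIso_hom_snd, Functor.comp_map, Category.assoc, ← H.map_comp, prodIso_hom_snd]
    exact prodIso_hom_snd ..

theorem terminalIso_comp : (PreservesTerminal.iso H).inv ≫ H.map (PreservesTerminal.iso G).inv =
    (PreservesTerminal.iso (G ⋙ H)).inv := by
  rw [← cancel_mono (PreservesTerminal.iso (G ⋙ H)).hom]
  exact Subsingleton.elim _ _

/-- Restricting along two regular functors successively is restricting along the composite. -/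
noncomputable def AjaxHom.ofComp (P : AjaxFunctor.{w, w', w''} E) :
    AjaxHom ((P.comp H).comp G) (P.comp (G ⋙ H)) where
  app X := (OrderHom.id : P.obj (H.obj (G.obj X)) →o P.obj (H.obj (G.obj X)))
  natural x a := by
    change P.map (mapFunctor H (mapFunctor G x)) a = P.map (mapFunctor (G ⋙ H) x) a
    rw [mapFunctor_mapFunctor]
  unit := by
    change P.map (mapFunctor H (graph _)) (P.map (graph _) P.unit) = P.map (graph _) P.unit
    rw [P.map_map, mapFunctor_graph, graph_comp_graph, terminalIso_comp]
  lax {X Y} a b := by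
    change P.map (mapFunctor H (graph _)) (P.map (graph _) (P.lax (a, b))) =
      P.map (graph _) (P.lax (a, b))
    rw [P.map_map, mapFunctor_graph, graph_comp_graph, prodIso_comp]

/-- Restricting along a composite of regular functors is restricting along them successively. -/
noncomputable def AjaxHom.toComp (P : AjaxFunctor.{w, w', w''} E) :
    AjaxHom (P.comp (G ⋙ H)) ((P.comp H).comp G) where
  app X := (OrderHom.id : P.obj (H.obj (G.obj X)) →o P.obj (H.obj (G.obj X)))
  natural x a := ((AjaxHom.ofComp G H P).natural x a).symm
  unit := (AjaxHom.ofComp G H P).unit.symm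
  lax a b := ((AjaxHom.ofComp G H P).lax a b).symm

end

theorem mapFunctor_natIso {G G' : D ⥤ C} [IsRegularFunctor G] [IsRegularFunctor G'] (κ : G ≅ G')
    {X Y : D} (x : Reln X Y) :
    (graph (κ.hom.app X)).comp (mapFunctor G' x) = (mapFunctor G x).comp (graph (κ.hom.app Y)) := by
  have h : graph (κ.hom.app Y) = cograph (κ.inv.app Y) := graph_iso (κ.app Y)
  apply ext'
  intro A a b
  rw [h, holds_graph_comp, holds_comp_cograph, holds_mapFunctor, holds_mapFunctor]
  constructor
  · rintro ⟨f, h1, h2⟩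
    refine ⟨f ≫ κ.inv.app _, ?_, ?_⟩
    · rw [Category.assoc, ← κ.inv.naturality, ← Category.assoc, h1]
      simp
    · rw [Category.assoc, ← κ.inv.naturality, ← Category.assoc, h2]
  · rintro ⟨f, h1, h2⟩
    refine ⟨f ≫ κ.hom.app _, ?_, ?_⟩
    · rw [Category.assoc, ← κ.hom.naturality, ← Category.assoc, h1]
    · rw [Category.assoc, ← κ.hom.naturality, ← Category.assoc, h2]
      simp

/-- Restricting along isomorphic regular functors. -/
noncomputable def AjaxHom.ofNatIso (P : AjaxFunctor.{u, v, w} C) {G G' : D ⥤ C}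
    [IsRegularFunctor G] [IsRegularFunctor G'] (κ : G ≅ G') :
    AjaxHom (P.comp G) (P.comp G') where
  app X := P.map (graph (κ.hom.app X))
  natural {X Y} x a := by
    change P.map (graph (κ.hom.app Y)) (P.map (mapFunctor G x) a) =
      P.map (mapFunctor G' x) (P.map (graph (κ.hom.app X)) a)
    rw [P.map_map, P.map_map, mapFunctor_natIso]
  unit := by
    change P.map (graph (κ.hom.app _)) (P.map (graph _) P.unit) = P.map (graph _) P.unit
    rw [P.map_map, graph_comp_graph]
    congr 3
    rw [← cancel_mono (PreservesTerminal.iso G').hom]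
    exact Subsingleton.elim _ _
  lax {X Y} a b := by
    change P.map (graph (κ.hom.app _)) (P.map (graph _) (P.lax (a, b))) =
      P.map (graph _) (P.lax (P.map (graph _) a, P.map (graph _) b))
    rw [P.map_map, P.lax_natural, P.map_map, graph_comp_graph, graph_tensor_graph,
      graph_comp_graph]
    congr 3
    apply hom_ext_prod
    · simp only [Category.assoc, ← κ.hom.naturality, prodIso_hom_fst, prodIso_hom_fst_assoc,
        prod.map_fst]
    · simp only [Category.assoc, ← κ.hom.naturality, prodIso_hom_snd, prodIso_hom_snd_assoc,
        prod.map_snd]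

end MorphismsOfAjaxFunctors

section SubobjectsFunctor

open Reln

variable {C : Type u} [Category.{v} C] [Regular C]
variable {D : Type u'} [Category.{v'} D] [Regular D] (F : D ⥤ C) [IsRegularFunctor F]

/-- The image of a subobject under a regular functor. -/
noncomputable def subMap {r : D} (φ : Subobject r) : Subobject (F.obj r) :=
  Subobject.mk (F.map φ.arrow)

theorem subMap_factors {r : D} {A : C} (φ : Subobject r) (c : A ⟶ F.obj r) :
    (subMap F φ).Factors c ↔ ∃ g : A ⟶ F.obj (φ : D), g ≫ F.map φ.arrow = c :=
  factors_mk_iff _ _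

theorem subMap_of_factors {r A : D} {φ : Subobject r} {a : A ⟶ r} (h : φ.Factors a) :
    (subMap F φ).Factors (F.map a) := by
  rw [subMap_factors]
  exact ⟨F.map (φ.factorThru a h), by rw [← F.map_comp, Subobject.factorThru_arrow]⟩

theorem arrow_factors {r : D} (φ : Subobject r) : φ.Factors φ.arrow :=
  (Subobject.factors_iff _ _).2 ⟨𝟙 _, by simp⟩

theorem subMap_mono {r : D} {φ ψ : Subobject r} (h : φ ≤ ψ) : subMap F φ ≤ subMap F ψ := by
  rw [le_iff_factors]
  intro A f hf
  obtain ⟨g, rfl⟩ := (subMap_factors ..).1 hf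
  exact Subobject.factors_of_factors_right _
    (subMap_of_factors F (Subobject.factors_of_le _ h (arrow_factors φ)))

theorem subMap_relImage {r s : D} (x : Reln r s) (φ : Subobject r) :
    subMap F (relImage x φ) = relImage (mapFunctor F x) (subMap F φ) := by
  apply ext_factors
  intro A c
  rw [relImage_factors]
  constructor
  · intro h
    obtain ⟨g, rfl⟩ := (subMap_factors ..).1 h
    obtain ⟨B, e, b, he, h1, h2⟩ := (relImage_factors ..).1 (arrow_factors (relImage x φ))
    have := IsRegularFunctor.map_strongEpi F e he
    have := strongEpi_pullback_fst g (F.map e)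
    refine ⟨_, pullback.fst g (F.map e), pullback.snd g (F.map e) ≫ F.map b, this,
      Subobject.factors_of_factors_right _ (subMap_of_factors F h1), ?_⟩
    have h3 := (h2.mapFunctor F).precomp (pullback.snd g (F.map e))
    rwa [F.map_comp e, ← Category.assoc (pullback.snd _ _) (F.map e), ← pullback.condition,
      Category.assoc] at h3
  · rintro ⟨B, e, b, he, h1, h2⟩
    obtain ⟨f, rfl⟩ := (subMap_factors ..).1 h1
    obtain ⟨g, hg1, hg2⟩ := (holds_mapFunctor ..).1 h2
    have hp := (IsPullback.of_hasPullback (x.arrow ≫ prod.fst) φ.arrow).map F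
    have h : (relImage x φ).Factors (pullback.fst (x.arrow ≫ prod.fst) φ.arrow ≫
        x.arrow ≫ prod.snd) := by
      rw [relImage_factors]
      refine ⟨_, 𝟙 _, pullback.snd (x.arrow ≫ prod.fst) φ.arrow ≫ φ.arrow, inferInstance,
        Subobject.factors_of_factors_right _ (arrow_factors φ), ?_⟩
      rw [Category.id_comp, ← pullback.condition]
      exact holds_arrow _ _
    obtain ⟨l, hl1, hl2⟩ := hp.exists_lift g f hg1
    have h' := Subobject.factors_of_factors_right l (subMap_of_factors F h)
    rw [F.map_comp (pullback.fst _ _), ← Category.assoc, hl1, hg2] at h'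
    exact factors_of_cover _ e _ h'

/-- The monoidal natural transformation from the subobjects of `D` to those of `C` that is induced by
a regular functor `F : D ⥤ C`. -/
noncomputable def subHom : AjaxHom (sub D) ((sub C).comp F) where
  app r := (⟨subMap F, fun _ _ h => subMap_mono F h⟩ : Subobject r →o Subobject (F.obj r))
  natural x a := subMap_relImage F x a
  unit := by
    apply ext_factors
    intro A c
    change (subMap F ⊤).Factors c ↔ (relImage (graph _) ⊤).Factors c
    rw [subMap_factors, relImage_graph_factors]
    constructor
    · intro _
      exact ⟨A, 𝟙 A, terminal.from A, inferInstance, Subobject.top_factors _, by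
        rw [← cancel_mono (PreservesTerminal.iso F).hom]
        exact Subsingleton.elim _ _⟩
    · intro _
      exact ⟨c ≫ F.map (inv (⊤ : Subobject (⊤_ D)).arrow), by
        rw [Category.assoc, ← F.map_comp, IsIso.inv_hom_id]; simp⟩
  lax {X Y} a b := by
    apply ext_factors
    intro A c
    change (subMap F (subProd a b)).Factors c ↔
      (relImage (graph (prodIso F X Y).hom) (subProd (subMap F a) (subMap F b))).Factors c
    rw [relImage_graph_iso_factors, subProd_factors, Category.assoc, Category.assoc,
      prodIso_inv_fst, prodIso_inv_snd]
    constructor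
    · intro h
      obtain ⟨g, rfl⟩ := (subMap_factors ..).1 h
      obtain ⟨h1, h2⟩ := (subProd_factors ..).1 (arrow_factors (subProd a b))
      constructor
      · rw [Category.assoc, ← F.map_comp]
        exact Subobject.factors_of_factors_right _ (subMap_of_factors F h1)
      · rw [Category.assoc, ← F.map_comp]
        exact Subobject.factors_of_factors_right _ (subMap_of_factors F h2)
    · rintro ⟨h1, h2⟩
      obtain ⟨g1, hg1⟩ := (subMap_factors ..).1 h1
      obtain ⟨g2, hg2⟩ := (subMap_factors ..).1 h2
      have h : (subProd a b).Factors (prod.map a.arrow b.arrow) := by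
        rw [subProd_factors, prod.map_fst, prod.map_snd]
        exact ⟨Subobject.factors_of_factors_right _ (arrow_factors a),
          Subobject.factors_of_factors_right _ (arrow_factors b)⟩
      have h' := Subobject.factors_of_factors_right (prod.lift g1 g2 ≫ (prodIso F _ _).hom)
        (subMap_of_factors F h)
      convert h' using 1
      apply hom_ext_prod
      · rw [← hg1, Category.assoc, Category.assoc, ← F.map_comp, prod.map_fst, F.map_comp,
          prodIso_hom_fst_assoc, prod.lift_fst_assoc]
      · rw [← hg2, Category.assoc, Category.assoc, ← F.map_comp, prod.map_snd, F.map_comp,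
          prodIso_hom_snd_assoc, prod.lift_snd_assoc]

end SubobjectsFunctor

section Calculi

open Reln

section Comparison

variable {R : Type u} [Category.{v} R] [Regular R]
variable {R' : Type u'} [Category.{v'} R'] [Regular R'] (F : R ⥤ R') [IsRegularFunctor F]

namespace FRg

theorem nonempty_hom_map_supp {r : R} {A : R'} (h : Nonempty (A ⟶ Supp (F.obj r))) :
    Nonempty (A ⟶ F.obj (Supp r)) := by
  obtain ⟨B, e, he, ⟨b⟩⟩ := nonempty_hom_supp_iff.1 h
  obtain ⟨g, -⟩ := (factors_mk_iff (F.map (image.ι (terminal.from r))) _).1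
    (factors_of_cover _ e (terminal.from A ≫ (PreservesTerminal.iso F).inv) (by
      rw [factors_mk_iff]
      refine ⟨b ≫ F.map (toSupp r), ?_⟩
      rw [← cancel_mono (PreservesTerminal.iso F).hom]
      exact Subsingleton.elim _ _))
  exact ⟨g⟩

theorem nonempty_map_supp_hom (r : R) : Nonempty (F.obj (Supp r) ⟶ Supp (F.obj r)) :=
  nonempty_hom_supp_iff.2 ⟨_, F.map (toSupp r), IsRegularFunctor.map_strongEpi F _ inferInstance,
    ⟨𝟙 _⟩⟩

/-- The canonical morphism from the image of the interpretation of a context to the interpretation of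
the image of the context, given by the images of the projections to the variables. -/
noncomputable def quoteComparison (Γ : FRg R) :
    F.obj ((quote R).obj Γ) ⟶ (quote R').obj ((map F.obj).obj Γ) :=
  liftObj ((map F.obj).obj Γ) (fun i => F.map (varπ Γ i)) (fun s =>
    (show Nonempty (F.obj ((quote R).obj Γ) ⟶ Supp s.1) by
      obtain ⟨_, r, hr, rfl⟩ := s
      exact ⟨F.map (suppπ Γ ⟨r, hr⟩) ≫ (nonempty_map_supp_hom F r).some⟩).some)

theorem quoteComparison_varπ (Γ : FRg R) (i : Fin Γ.n) :
    quoteComparison F Γ ≫ varπ ((map F.obj).obj Γ) i = F.map (varπ Γ i) :=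
  liftObj_varπ ..

theorem exists_lift_map (Γ : FRg R) {A : R'} (a : ∀ i, A ⟶ F.obj (Γ.τ i))
    (b : ∀ s : Γ.supp, A ⟶ F.obj (Supp s.1)) :
    ∃ c : A ⟶ F.obj ((quote R).obj Γ), ∀ i, c ≫ F.map (varπ Γ i) = a i := by
  refine ⟨prod.lift (Pi.lift a ≫ (PreservesProduct.iso F _).inv)
    (Pi.lift b ≫ (PreservesProduct.iso F _).inv) ≫ (prodIso F _ _).hom, fun i => ?_⟩
  have h : F.map (varπ Γ i) = F.map prod.fst ≫ F.map (Pi.π (fun i => Γ.τ i) i) := by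
    rw [← F.map_comp]; rfl
  rw [h, Category.assoc, prodIso_hom_fst_assoc, prod.lift_fst_assoc, Category.assoc]
  have h' : (PreservesProduct.iso F Γ.τ).inv ≫ F.map (Pi.π (fun i => Γ.τ i) i) = Pi.π _ i := by
    rw [Iso.inv_comp_eq, PreservesProduct.iso_hom, piComparison_comp_π]
  rw [h', Pi.lift_π]

theorem map_ext (Γ : FRg R) {A : R'} {a b : A ⟶ F.obj ((quote R).obj Γ)}
    (h : ∀ i, a ≫ F.map (varπ Γ i) = b ≫ F.map (varπ Γ i)) : a = b := by
  have hs : ∀ r : R, Subsingleton (A ⟶ F.obj (Supp r)) := fun r =>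
    ⟨fun f g => (cancel_mono (F.map (image.ι (terminal.from r)) ≫
      (PreservesTerminal.iso F).hom)).1 (Subsingleton.elim _ _)⟩
  apply hom_ext_prod F
  · rw [← cancel_mono (PreservesProduct.iso F Γ.τ).hom]
    apply Pi.hom_ext
    intro i
    have h' := h i
    have e : F.map (varπ Γ i) = F.map prod.fst ≫ F.map (Pi.π (fun i => Γ.τ i) i) := by
      rw [← F.map_comp]; rfl
    rw [e] at h'
    simpa only [Category.assoc, PreservesProduct.iso_hom, piComparison_comp_π] using h'
  · rw [← cancel_mono (PreservesProduct.iso F fun s : Γ.supp => Supp s.1).hom]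
    apply Pi.hom_ext
    intro i
    exact Subsingleton.elim _ _

instance (Γ : FRg R) : IsIso (quoteComparison F Γ) := by
  have : Mono (quoteComparison F Γ) := ⟨fun a b h => map_ext F Γ fun i => by
    rw [← quoteComparison_varπ, ← Category.assoc, h, Category.assoc]⟩
  obtain ⟨c, hc⟩ := exists_lift_map F Γ (fun i => varπ ((map F.obj).obj Γ) i)
    (fun s => (nonempty_hom_map_supp F
      ⟨suppπ ((map F.obj).obj Γ) ⟨F.obj s.1, Set.mem_image_of_mem _ s.2⟩⟩).some)
  have h : c ≫ quoteComparison F Γ = 𝟙 _ := obj_ext fun i => by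
    rw [Category.assoc, quoteComparison_varπ, hc, Category.id_comp]
  exact ⟨c, by rw [← cancel_mono (quoteComparison F Γ), Category.assoc, h]; simp, h⟩

/-- A regular functor `F` commutes with the interpretation of contexts up to canonical isomorphism. -/
noncomputable def quoteIso : quote R ⋙ F ≅ map F.obj ⋙ quote R' :=
  NatIso.ofComponents (fun Γ => asIso (quoteComparison F Γ)) (fun {Γ Γ'} f => obj_ext fun i => by
    have h1 : (quote R').map ((map F.obj).map f) ≫ varπ ((map F.obj).obj Γ') i =
        varπ ((map F.obj).obj Γ) (f.fn i) ≫ eqToHom (congrArg F.obj (f.τ_fn i)) := map_varπ ..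
    simp only [asIso_hom, Functor.comp_map, Category.assoc]
    rw [h1, quoteComparison_varπ, ← F.map_comp, map_varπ, F.map_comp, eqToHom_map,
      ← Category.assoc (quoteComparison F Γ)]
    congr 1
    exact (quoteComparison_varπ F Γ _).symm)

end FRg

end Comparison

/-- A regular calculus: a set of types together with an ajax po-functor on the po-category of
relations in the free regular category on this set. -/
structure RegularCalculus where
  /-- the set of types -/
  T : Type u
  /-- the ajax po-functor -/
  P : AjaxFunctor.{u, 0, w} (FRg T)

namespace RegularCalculus

/-- A morphism of regular calculi: a function between the sets of types, together with a strict
monoidal natural transformation. -/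
structure Hom (A : RegularCalculus.{u, w}) (B : RegularCalculus.{u', w'}) where
  /-- the function on types -/
  base : A.T → B.T
  /-- the monoidal natural transformation -/
  trans : AjaxHom A.P (B.P.comp (FRg.map base))

end RegularCalculus

/-- The regular calculus of predicates of a regular category `R`: the types are the objects of `R`,
and the poset of a context consists of the subobjects of its interpretation in `R`. -/
noncomputable abbrev prd (R : Type u) [Category.{v} R] [Regular R] :
    RegularCalculus.{u, max u v} :=
  ⟨R, (sub R).comp (FRg.quote R)⟩

/-- The morphism between the regular calculi of predicates induced by a regular functor `F`: on
types it is the object part of `F`, on subobjects it is the application of `F`, followed by the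
canonical isomorphism between the image of the interpretation of a context and the interpretation
of the image of the context. -/
noncomputable def prdMap {R : Type u} [Category.{v} R] [Regular R] {R' : Type u'}
    [Category.{v'} R'] [Regular R'] (F : R ⥤ R') [IsRegularFunctor F] :
    (prd R).Hom (prd R') where
  base := F.obj
  trans := ((((subHom F).whisker (FRg.quote R)).comp
    (AjaxHom.ofComp (FRg.quote R) F (sub R'))).comp
    (AjaxHom.ofNatIso (sub R') (FRg.quoteIso F))).comp
    (AjaxHom.toComp (FRg.map F.obj) (FRg.quote R') (sub R'))

/-- The syntactic category of a regular calculus: the category of left adjoints in its po-category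
of internal relations. -/
abbrev Syn (A : RegularCalculus.{u, w}) : Type (max u w) := LAdj (IntRel A.P)

/-- The functor between syntactic categories induced by a morphism of regular calculi. -/
noncomputable def synMap {A : RegularCalculus.{u, w}} {B : RegularCalculus.{u', w'}}
    (f : A.Hom B) : Syn A ⥤ Syn B :=
  LAdj.mapFunctor (IntRel.map (FRg.map f.base) f.trans)
    (fun h => IntRel.map_mono (FRg.map f.base) f.trans h)

end Calculi

section InternalRelationsOfPredicates

open Reln

variable {R : Type u} [Category.{v} R] [Regular R]

/-- For an object `(Γ, r)` of the po-category of internal relations of `prd R`, where `r` is a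
subobject of the interpretation of `Γ` in `R`: the object `r` of `R`. -/
noncomputable def carrier (X : IntRel (prd R).P) : R :=
  ((show Subobject ((FRg.quote R).obj X.ctx) from X.pred : Subobject _) : R)

/-- The inclusion of `r` into the interpretation of `Γ`. -/
noncomputable def incl (X : IntRel (prd R).P) : carrier X ⟶ (FRg.quote R).obj X.ctx :=
  (show Subobject ((FRg.quote R).obj X.ctx) from X.pred).arrow

/-- The relation between `r₁` and `r₂` given by an internal relation between `(Γ₁, r₁)` and
`(Γ₂, r₂)`: the subobject of `r₁ × r₂` obtained by restricting a subobject of the interpretation of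
`Γ₁ × Γ₂`, which is the product of the interpretations of `Γ₁` and `Γ₂`. -/
noncomputable def restrict {X Y : IntRel (prd R).P} (θ : X ⟶ Y) : Reln (carrier X) (carrier Y) :=
  (Subobject.pullback
    (prod.map (incl X) (incl Y) ≫ (prodIso (FRg.quote R) X.ctx Y.ctx).hom)).obj θ.1

end InternalRelationsOfPredicates

end GraphicalRegularLogic

open GraphicalRegularLogic

-- An internal relation from (Γ₁, r₁) to (Γ₂, r₂) in the calculus of predicates is a subobject θ of
-- ⌜Γ₁⌝ × ⌜Γ₂⌝. The two bounds on θ say exactly that both coordinates of every generalized element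
-- of θ lie in r₁ and r₂, that is, θ ⊆ r₁ × r₂. Restricting along the mono r₁ × r₂ → ⌜Γ₁⌝ × ⌜Γ₂⌝
-- therefore loses nothing and reaches every relation between r₁ and r₂ (`restrict_le_iff`,
-- `restrict_surjective`). Identities and composites match because both sides have the same local
-- description: after passing to a cover there is a middle element, and the bounds force it to lie
-- in the middle carrier (`restrict_id`, `restrict_comp`).
--
-- So internal relations form the po-category of relations between carriers, and left adjoints
-- correspond to left adjoints there. In a regular category these are precisely the graphs: the unit
-- makes the relation total, the counit makes it single-valued, and a first projection that is both
-- a mono and a strong epi is invertible (`exists_eq_graph`). Sending a left adjoint to the morphism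
-- of which its restriction is the graph is thus a fully faithful functor. It is essentially
-- surjective because every object r embeds in the interpretation r × Supp r of a one-variable
-- context (`exists_mono_to_quote`).
--
-- None of this uses contexts except the last embedding, so it is carried out for an arbitrary
-- regular functor G : D ⥤ R in place of ⌜-⌝; for G = ⌜-⌝ the notions of carrier, inclusion and
-- restriction become, by definition, those of the statement. Naturality is likewise proved for any
-- square of regular functors that commutes up to an isomorphism κ. The image of (Γ, r) is
-- represented by F(r) → F(G Γ) ≅ G'(H Γ) (`imagePredicate_eq`), which yields the isomorphism of
-- carriers. Its naturality needs only that the restricted image of θ is contained in the image of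
-- the restriction (`mapFunctor_restrict_holds`), because for graphs containment already determines
-- the morphism.

universe u₁ v₁

namespace GraphicalRegularLogic

/-! ### Left adjoints among relations are graphs. -/

namespace Reln

section LeftAdjoints

variable {C : Type u} [Category.{v} C] [Regular C]

/-- The generic element `𝟙 r` has only one partner in a graph. This lets equations between
morphisms, in particular functoriality, be checked on relations. -/
theorem graph_injective {r s : C} : Function.Injective (graph : (r ⟶ s) → Reln r s) := by
  intro f g h
  have hf : (graph f).Holds (𝟙 r) f := by simp
  rw [h] at hf
  simpa using hf

/-- The unit of the adjunction between a graph and its cograph: f is defined everywhere. -/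
theorem graph_le_comp_cograph {r s : C} (f : r ⟶ s) :
    graph (𝟙 r) ≤ (graph f).comp (cograph f) := by
  rw [le_iff]
  intro A a b h
  rw [holds_graph, Category.comp_id] at h
  rw [holds_comp_cograph, holds_graph, h]

/-- The counit: two elements with a common preimage under f coincide. The preimage exists only on a
cover, but equality descends along epimorphisms. -/
theorem cograph_comp_le_graph {r s : C} (f : r ⟶ s) :
    (cograph f).comp (graph f) ≤ graph (𝟙 s) := by
  rw [le_iff]
  intro A a b h
  obtain ⟨B, e, t, he, h1, h2⟩ := (holds_cograph_comp_graph f f a b).1 h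
  rw [holds_graph, ← cancel_epi e, h2, ← h1, Category.comp_id]

/-- A relation with a right adjoint is the graph of a morphism. -/
theorem exists_eq_graph {r s : C} {x : Reln r s} {y : Reln s r} (h : graph (𝟙 r) ≤ x.comp y)
    (h' : y.comp x ≤ graph (𝟙 s)) : ∃ f : r ⟶ s, x = graph f := by
  rw [le_iff] at h h'
  -- Totality is the unit tested on the pair (a, a). The value c exists only after a cover, and y
  -- relates it back to a.
  have total : ∀ {A : C} (a : A ⟶ r), ∃ (B : C) (e : B ⟶ A) (c : B ⟶ s), StrongEpi e ∧
      x.Holds (e ≫ a) c ∧ y.Holds c (e ≫ a) := fun a =>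
    (holds_comp ..).1 (h _ a a (by simp))
  have unique : ∀ {A : C} {a : A ⟶ r} {b b' : A ⟶ s}, x.Holds a b → x.Holds a b' → b = b' := by
    intro A a b b' hb hb'
    obtain ⟨B, e, c, he, -, hy⟩ := total a
    -- On the cover, y relates c to a and x relates a to d, so the counit identifies c with d. As c
    -- does not depend on d, all values of a agree.
    have key : ∀ {d : A ⟶ s}, x.Holds a d → e ≫ d = c := by
      intro d hd
      have := h' _ c (e ≫ d) ((holds_comp ..).2
        ⟨B, 𝟙 B, e ≫ a, inferInstance, by simpa using hy, by simpa using hd.precomp e⟩)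
      simpa using this
    rw [← cancel_epi e, key hb, key hb']
  -- Single-valuedness says that the first coordinate of an element of x determines the second.
  have : Mono (x.arrow ≫ prod.fst) := ⟨fun f g hfg => by
    have hf := holds_arrow x f
    have hg := holds_arrow x g
    rw [hfg] at hf
    rw [← cancel_mono x.arrow]
    apply prod.hom_ext
    · simpa using hfg
    · simpa using unique hf hg⟩
  have : StrongEpi (x.arrow ≫ prod.fst) := by
    -- Totality at the generic element provides a cover e of r that factors through the first
    -- projection of x, and the last factor of a strong epimorphism is again one.
    obtain ⟨B, e, c, he, hx, -⟩ := total (𝟙 r)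
    obtain ⟨f, hf, -⟩ := hx.exists_arrow
    rw [Category.comp_id] at hf
    rw [← hf] at he
    exact strongEpi_of_strongEpi f _
  have : IsIso (x.arrow ≫ prod.fst) := isIso_of_mono_of_strongEpi _
  have hx : x.Holds (𝟙 r) (inv (x.arrow ≫ prod.fst) ≫ x.arrow ≫ prod.snd) := by
    simpa only [IsIso.inv_hom_id] using holds_arrow x (inv (x.arrow ≫ prod.fst))
  -- The function is the second projection of x read along the inverse of the first; by uniqueness x
  -- relates a to nothing but its value at a.
  refine ⟨inv (x.arrow ≫ prod.fst) ≫ x.arrow ≫ prod.snd, ext' fun A a b => ?_⟩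
  rw [holds_graph]
  have ha := hx.precomp a
  rw [Category.comp_id] at ha
  exact ⟨fun hb => unique hb ha, fun hb => hb ▸ ha⟩

end LeftAdjoints

end Reln

/-! ### Direct images and generalized elements of products. -/

section InternalRelationsOfSubobjects

open Reln

variable {R : Type u} [Category.{v} R] [Regular R]

/-- Elements of a direct image are images only after a cover, but membership in ψ descends along
covers, so no cover remains in the criterion. -/
theorem relImage_graph_le_iff {r s : R} (f : r ⟶ s) (φ : Subobject r) (ψ : Subobject s) :
    relImage (graph f) φ ≤ ψ ↔ ∀ (A : R) (a : A ⟶ r), φ.Factors a → ψ.Factors (a ≫ f) := by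
  rw [le_iff_factors]
  constructor
  · intro h A a ha
    exact h _ _ ((relImage_graph_factors ..).2 ⟨A, 𝟙 A, a, inferInstance, ha, by simp⟩)
  · intro h A c hc
    obtain ⟨B, e, b, he, h1, h2⟩ := (relImage_graph_factors ..).1 hc
    apply factors_of_cover _ e
    rw [h2]
    exact h _ _ h1

variable {D : Type u'} [Category.{v'} D] [Regular D] {G : D ⥤ R} [IsRegularFunctor G]

/-- The generalized element of `G (Γ × Γ')` with given components. -/
noncomputable def pair {Γ Γ' : D} {A : R} (a : A ⟶ G.obj Γ) (b : A ⟶ G.obj Γ') :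
    A ⟶ G.obj (Γ ⨯ Γ') :=
  prod.lift a b ≫ (prodIso G Γ Γ').hom

@[simp] theorem pair_fst {Γ Γ' : D} {A : R} (a : A ⟶ G.obj Γ) (b : A ⟶ G.obj Γ') :
    pair a b ≫ G.map prod.fst = a := by
  rw [pair, Category.assoc, prodIso_hom_fst, prod.lift_fst]

@[simp] theorem pair_snd {Γ Γ' : D} {A : R} (a : A ⟶ G.obj Γ) (b : A ⟶ G.obj Γ') :
    pair a b ≫ G.map prod.snd = b := by
  rw [pair, Category.assoc, prodIso_hom_snd, prod.lift_snd]

@[simp] theorem pair_fst_assoc {Γ Γ' : D} {A B : R} (a : A ⟶ G.obj Γ) (b : A ⟶ G.obj Γ')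
    (c : G.obj Γ ⟶ B) : pair a b ≫ G.map prod.fst ≫ c = a ≫ c := by
  rw [← Category.assoc, pair_fst]

@[simp] theorem pair_snd_assoc {Γ Γ' : D} {A B : R} (a : A ⟶ G.obj Γ) (b : A ⟶ G.obj Γ')
    (c : G.obj Γ' ⟶ B) : pair a b ≫ G.map prod.snd ≫ c = b ≫ c := by
  rw [← Category.assoc, pair_snd]

theorem eq_pair {Γ Γ' : D} {A : R} {a : A ⟶ G.obj Γ} {b : A ⟶ G.obj Γ'} {t : A ⟶ G.obj (Γ ⨯ Γ')}
    (h1 : a = t ≫ G.map prod.fst) (h2 : b = t ≫ G.map prod.snd) : t = pair a b :=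
  hom_ext_prod _ (by rw [pair_fst, h1]) (by rw [pair_snd, h2])

theorem pair_eq_pair_iff {Γ Γ' : D} {A : R} {a a' : A ⟶ G.obj Γ} {b b' : A ⟶ G.obj Γ'} :
    pair a b = pair a' b' ↔ a = a' ∧ b = b' := by
  constructor
  · intro h
    exact ⟨by simpa using congrArg (· ≫ G.map prod.fst) h,
      by simpa using congrArg (· ≫ G.map prod.snd) h⟩
  · rintro ⟨rfl, rfl⟩
    rfl

theorem comp_pair {Γ Γ' : D} {A B : R} (e : B ⟶ A) (a : A ⟶ G.obj Γ) (b : A ⟶ G.obj Γ') :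
    e ≫ pair a b = pair (e ≫ a) (e ≫ b) :=
  eq_pair (by rw [Category.assoc, pair_fst]) (by rw [Category.assoc, pair_snd])

/-! ### Restriction of internal relations to carriers, over an arbitrary regular functor. -/

namespace SubRel

/-- The subobject of `G Γ` given by an object `(Γ, r)` of internal relations. -/
def predicate (X : IntRel ((sub R).comp G)) : Subobject (G.obj X.ctx) := X.pred

/-- The object of `R` underlying the subobject `r` of an object `(Γ, r)` of internal relations. -/
noncomputable def carrier (X : IntRel ((sub R).comp G)) : R := (predicate X : R)

/-- The inclusion of the carrier. -/
noncomputable def incl (X : IntRel ((sub R).comp G)) : carrier X ⟶ G.obj X.ctx :=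
  (predicate X).arrow

instance (X : IntRel ((sub R).comp G)) : Mono (incl X) :=
  inferInstanceAs (Mono (predicate X).arrow)

/-- The subobject of `G (Γ₁ × Γ₂)` underlying an internal relation. -/
def underlying {X Y : IntRel ((sub R).comp G)} (θ : X ⟶ Y) :
    Subobject (G.obj (X.ctx ⨯ Y.ctx)) := θ.1

/-- The relation between the carriers obtained by restricting an internal relation. -/
noncomputable def restrict {X Y : IntRel ((sub R).comp G)} (θ : X ⟶ Y) :
    Reln (carrier X) (carrier Y) :=
  (Subobject.pullback (prod.map (incl X) (incl Y) ≫ (prodIso G X.ctx Y.ctx).hom)).obj θ.1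

theorem predicate_factors_iff (X : IntRel ((sub R).comp G)) {A : R} (a : A ⟶ G.obj X.ctx) :
    (predicate X).Factors a ↔ ∃ b : A ⟶ carrier X, b ≫ incl X = a :=
  ⟨fun h => ⟨(predicate X).factorThru a h, Subobject.factorThru_arrow _ _ _⟩,
    fun ⟨b, hb⟩ => hb ▸ Subobject.factors_comp_arrow (P := predicate X) b⟩

/-- Puts the two bounds in `IntRel.Hom` into elementwise form; it rests on G taking the graph of f
to the graph of `G.map f`. -/
theorem map_graph_le_iff {Γ Γ' : D} (f : Γ ⟶ Γ') (t : Subobject (G.obj Γ))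
    (ψ : Subobject (G.obj Γ')) :
    ((sub R).comp G).map (graph f) t ≤ ψ ↔ ∀ (A : R) (a : A ⟶ G.obj Γ), t.Factors a →
      ψ.Factors (a ≫ G.map f) := by
  rw [← relImage_graph_le_iff, ← mapFunctor_graph]
  rfl

variable {X Y Z : IntRel ((sub R).comp G)}

/-- This is where the bounds on an internal relation enter: they place both coordinates of every
element of θ in the carriers, so θ ⊆ r₁ × r₂ and θ can be recovered from its restriction. -/
theorem exists_components (θ : X ⟶ Y) {A : R} {t : A ⟶ G.obj (X.ctx ⨯ Y.ctx)}
    (h : (underlying θ).Factors t) :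
    ∃ (a : A ⟶ carrier X) (b : A ⟶ carrier Y), a ≫ incl X = t ≫ G.map prod.fst ∧
      b ≫ incl Y = t ≫ G.map prod.snd := by
  obtain ⟨a, ha⟩ := (predicate_factors_iff X _).1 ((map_graph_le_iff _ _ _).1 θ.2.1 A t h)
  obtain ⟨b, hb⟩ := (predicate_factors_iff Y _).1 ((map_graph_le_iff _ _ _).1 θ.2.2 A t h)
  exact ⟨a, b, ha, hb⟩

/-- The dictionary between the two sides: the restriction is a pullback along the product of the
inclusions, so membership in it is membership of the included pair in θ. -/
theorem holds_restrict (θ : X ⟶ Y) {A : R} (a : A ⟶ carrier X) (b : A ⟶ carrier Y) :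
    (restrict θ).Holds a b ↔ (underlying θ).Factors (pair (a ≫ incl X) (b ≫ incl Y)) := by
  have h : prod.lift a b ≫ prod.map (incl X) (incl Y) ≫ (prodIso G X.ctx Y.ctx).hom =
      pair (a ≫ incl X) (b ≫ incl Y) := by
    rw [← Category.assoc, prod.lift_map]
    rfl
  rw [← h]
  exact factors_pullback _ _ _

/-- Containment may be tested on pairs of elements of the carriers, because by `exists_components` θ
has no other elements. Order reflection gives injectivity at once. -/
theorem restrict_le_iff (θ θ' : X ⟶ Y) : restrict θ ≤ restrict θ' ↔ θ ≤ θ' := by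
  have h : θ ≤ θ' ↔ underlying θ ≤ underlying θ' := Iff.rfl
  rw [h, Reln.le_iff, le_iff_factors]
  constructor
  · intro h A t ht
    obtain ⟨a, b, ha, hb⟩ := exists_components θ ht
    rw [eq_pair ha hb, ← holds_restrict] at ht ⊢
    exact h _ _ _ ht
  · intro h A a b hab
    rw [holds_restrict] at hab ⊢
    exact h _ _ hab

theorem restrict_injective : Function.Injective (fun θ : X ⟶ Y => restrict θ) := fun _ _ h =>
  le_antisymm ((restrict_le_iff _ _).1 (le_of_eq h)) ((restrict_le_iff _ _).1 (ge_of_eq h))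

/-- A relation x ⊆ r₁ × r₂ is extended by composing with the inclusion r₁ × r₂ → G Γ₁ × G Γ₂. The
extension satisfies the bounds since its coordinates come from the carriers, and restricting it
returns x since the inclusions are monic. -/
theorem restrict_surjective : Function.Surjective (fun θ : X ⟶ Y => restrict θ) := by
  intro x
  have hm : Mono (pair ((x.arrow ≫ prod.fst) ≫ incl X) ((x.arrow ≫ prod.snd) ≫ incl Y)) := by
    refine ⟨fun f g h => ?_⟩
    rw [comp_pair, comp_pair, pair_eq_pair_iff, ← Category.assoc, ← Category.assoc f,
      ← Category.assoc g, ← Category.assoc g, cancel_mono (incl X), ← Category.assoc f,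
      ← Category.assoc g, cancel_mono (incl Y)] at h
    rw [← cancel_mono x.arrow]
    apply prod.hom_ext
    · simpa using h.1
    · simpa using h.2
  let t : Subobject (G.obj (X.ctx ⨯ Y.ctx)) :=
    Subobject.mk (pair ((x.arrow ≫ prod.fst) ≫ incl X) ((x.arrow ≫ prod.snd) ≫ incl Y))
  have ht : ∀ {A : R} (c : A ⟶ G.obj (X.ctx ⨯ Y.ctx)), t.Factors c ↔
      ∃ g : A ⟶ (x : R), pair ((g ≫ x.arrow ≫ prod.fst) ≫ incl X)
        ((g ≫ x.arrow ≫ prod.snd) ≫ incl Y) = c := by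
    intro A c
    rw [factors_mk_iff]
    simp only [comp_pair, Category.assoc]
  refine ⟨⟨t, (map_graph_le_iff _ _ _).2 ?_, (map_graph_le_iff _ _ _).2 ?_⟩,
    ext' fun A a b => (holds_restrict _ a b).trans ((ht _).trans ?_)⟩
  · intro A c hc
    obtain ⟨g, rfl⟩ := (ht c).1 hc
    exact (predicate_factors_iff X _).2 ⟨_, (pair_fst _ _).symm⟩
  · intro A c hc
    obtain ⟨g, rfl⟩ := (ht c).1 hc
    exact (predicate_factors_iff Y _).2 ⟨_, (pair_snd _ _).symm⟩
  · simp only [pair_eq_pair_iff, cancel_mono]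
    constructor
    · rintro ⟨g, rfl, rfl⟩
      exact holds_arrow x g
    · exact Holds.exists_arrow

/-- The direct image of r along the diagonal consists of the pairs that are locally of the form (t,
t) with t in r. Equality descends along covers and is reflected by the inclusion of the carrier. -/
theorem restrict_id (X : IntRel ((sub R).comp G)) :
    restrict (𝟙 X) = graph (𝟙 (carrier X)) := by
  apply ext'
  intro A a b
  -- Holds by definition once the graph of `G.map (diag _)` is written as the image under G of the
  -- graph of the diagonal.
  have h : underlying (𝟙 X) = relImage (graph (G.map (diag X.ctx))) (predicate X) := by
    rw [← mapFunctor_graph]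
    rfl
  have hd : ∀ {B : R} (t : B ⟶ G.obj X.ctx), t ≫ G.map (diag X.ctx) = pair t t := fun t =>
    eq_pair (by rw [Category.assoc, ← G.map_comp, prod.lift_fst]; simp)
      (by rw [Category.assoc, ← G.map_comp, prod.lift_snd]; simp)
  rw [holds_restrict, holds_graph, Category.comp_id, h, relImage_graph_factors]
  constructor
  · rintro ⟨B, e, t, he, -, h2⟩
    rw [hd, comp_pair, pair_eq_pair_iff] at h2
    rw [← cancel_epi e, ← cancel_mono (incl X), Category.assoc, Category.assoc, h2.1, h2.2]
  · rintro rfl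
    exact ⟨A, 𝟙 A, b ≫ incl X, inferInstance, (predicate_factors_iff _ _).2 ⟨b, rfl⟩, by
      rw [hd, Category.id_comp]⟩

/-- Both composites ask for a middle element on some cover: the internal one in G Γ₂, the one of
restrictions in the carrier of Y. They agree because the bounds on θ allow only middle elements in
that carrier. -/
theorem restrict_comp (θ : X ⟶ Y) (θ' : Y ⟶ Z) :
    restrict (θ ≫ θ') = (restrict θ).comp (restrict θ') := by
  apply ext'
  intro A a c
  have h : underlying (θ ≫ θ') = relImage (mapFunctor G
      (compDiagram X.ctx Y.ctx Z.ctx)) (relImage (graph (prodIso G _ _).hom)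
        (subProd (underlying θ) (underlying θ'))) := rfl
  rw [holds_restrict, h, relImage_factors, holds_comp]
  simp only [relImage_graph_iso_factors, subProd_factors, Category.assoc, prodIso_inv_fst,
    prodIso_inv_snd, holds_mapFunctor_compDiagram, holds_restrict]
  refine exists_congr fun B => exists_congr fun e => ?_
  constructor
  · rintro ⟨t, he, ⟨h1, h2⟩, h3, h4, h5⟩
    -- The second coordinate of the θ-part of t is the middle element, here lifted to the carrier of
    -- Y. By `h3` it is also the first coordinate of the θ'-part.
    obtain ⟨a', b, -, hb⟩ := exists_components θ h1
    simp only [Functor.map_comp, pair_fst, pair_snd] at h3 h4 h5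
    simp only [Category.assoc] at hb
    refine ⟨b, he, ?_, ?_⟩
    · rwa [hb, h4, ← eq_pair (Category.assoc _ _ _).symm (Category.assoc _ _ _).symm]
    · rwa [hb, h5, h3, ← eq_pair (Category.assoc _ _ _).symm (Category.assoc _ _ _).symm]
  · rintro ⟨b, he, h1, h2⟩
    -- Conversely, the middle element is duplicated, so that the gluing condition of `compDiagram`
    -- holds trivially.
    refine ⟨pair (pair (e ≫ a ≫ incl X) (b ≫ incl Y)) (pair (b ≫ incl Y) (e ≫ c ≫ incl Z)), he,
      ?_, ?_⟩
    · rw [pair_fst, pair_snd]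
      simpa using ⟨h1, h2⟩
    · simp

/-! ### Left adjoints and the equivalence with R. -/

/-- The restriction of a left adjoint in the po-category of internal relations is a graph. -/
theorem exists_restrict_eq_graph {θ : X ⟶ Y} (h : IsLeftAdj θ) :
    ∃ f : carrier X ⟶ carrier Y, restrict θ = graph f := by
  obtain ⟨θ', h1, h2⟩ := h
  apply exists_eq_graph (y := restrict θ')
  · rwa [← restrict_id, ← restrict_comp, restrict_le_iff]
  · rwa [← restrict_id, ← restrict_comp, restrict_le_iff]

/-- The cograph of f is itself the restriction of some internal relation. That relation is the right
adjoint, since restriction reflects the order and respects identities and composites. -/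
theorem isLeftAdj_of_restrict_eq_graph {θ : X ⟶ Y} {f : carrier X ⟶ carrier Y}
    (h : restrict θ = graph f) : IsLeftAdj θ := by
  obtain ⟨θ', h'⟩ := restrict_surjective (X := Y) (Y := X) (cograph f)
  dsimp only at h'
  refine ⟨θ', ?_, ?_⟩
  · rw [← restrict_le_iff, restrict_comp, restrict_id, h, h']
    exact graph_le_comp_cograph f
  · rw [← restrict_le_iff, restrict_comp, restrict_id, h, h']
    exact cograph_comp_le_graph f

/-- The functor that sends a left adjoint between internal relations of subobjects to the morphism
whose graph is its restriction. -/
noncomputable def toMorphism (G : D ⥤ R) [IsRegularFunctor G] :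
    LAdj (IntRel ((sub R).comp G)) ⥤ R where
  obj X := carrier X.of
  -- The choice is no choice: by `graph_injective` the morphism is determined by its graph, and for
  -- the same reason the functor laws reduce to those for relations.
  map θ := (exists_restrict_eq_graph θ.2).choose
  map_id X := graph_injective <| by
    rw [← (exists_restrict_eq_graph (𝟙 X : X ⟶ X).2).choose_spec]
    exact restrict_id X.of
  map_comp {X Y Z} θ θ' := graph_injective <| by
    rw [← graph_comp_graph, ← (exists_restrict_eq_graph θ.2).choose_spec,
      ← (exists_restrict_eq_graph θ'.2).choose_spec, ← restrict_comp]
    exact (exists_restrict_eq_graph (θ ≫ θ').2).choose_spec.symm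

theorem restrict_eq_graph {X Y : LAdj (IntRel ((sub R).comp G))} (θ : X ⟶ Y) :
    restrict θ.1 = graph ((toMorphism G).map θ) :=
  (exists_restrict_eq_graph θ.2).choose_spec

/-- The image of θ determines its graph, hence the restriction of θ, hence θ. -/
instance : (toMorphism G).Faithful where
  map_injective h := Subtype.ext (restrict_injective (by
    dsimp only
    rw [restrict_eq_graph, restrict_eq_graph, h]))

/-- The graph of any f lifts to an internal relation, which is then automatically a left adjoint. -/
instance : (toMorphism G).Full where
  map_surjective {X Y} f := by
    obtain ⟨θ, h⟩ := restrict_surjective (X := X.of) (Y := Y.of) (graph f)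
    refine ⟨⟨θ, isLeftAdj_of_restrict_eq_graph h⟩, graph_injective ?_⟩
    rw [← restrict_eq_graph]
    exact h

/-- Only essential surjectivity demands anything of G: a mono r → G Γ exhibits r, up to isomorphism,
as the carrier of an object over Γ. -/
theorem isEquivalence_toMorphism (h : ∀ r : R, ∃ (Γ : D) (m : r ⟶ G.obj Γ), Mono m) :
    (toMorphism G).IsEquivalence where
  essSurj := ⟨fun r => by
    obtain ⟨Γ, m, hm⟩ := h r
    exact ⟨⟨⟨Γ, Subobject.mk m⟩⟩, ⟨Subobject.underlyingIso m⟩⟩⟩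

/-! ### Naturality along a square of regular functors. -/

section Naturality

variable {R' : Type w} [Category.{w'} R'] [Regular R'] {D' : Type u₁} [Category.{v₁} D'] [Regular D']
  {G' : D' ⥤ R'} [IsRegularFunctor G'] (F : R ⥤ R') [IsRegularFunctor F] (H : D ⥤ D')
  [IsRegularFunctor H] (κ : G ⋙ F ≅ H ⋙ G')

/-- The monoidal natural transformation induced by a square of regular functors that commutes up to
isomorphism. -/
noncomputable abbrev squareTrans : AjaxHom ((sub R).comp G) (((sub R').comp G').comp H) :=
  ((((subHom F).whisker G).comp (AjaxHom.ofComp G F (sub R'))).comp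
    (AjaxHom.ofNatIso (sub R') κ)).comp (AjaxHom.toComp H G' (sub R'))

/-- The functor on internal relations induced by a square of regular functors that commutes up to
isomorphism. -/
noncomputable abbrev squareMap : IntRel ((sub R).comp G) ⥤ IntRel ((sub R').comp G') :=
  IntRel.map H (squareTrans F H κ)

/-- The components of the isomorphism that fills a square of functors. -/
def squareIso (Γ : D) : F.obj (G.obj Γ) ≅ G'.obj (H.obj Γ) := κ.app Γ

theorem squareIso_naturality {Γ Γ' : D} (f : Γ ⟶ Γ') :
    F.map (G.map f) ≫ (squareIso F H κ Γ').hom = (squareIso F H κ Γ).hom ≫ G'.map (H.map f) :=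
  κ.hom.naturality f

/-- The subobject of `G' (H Γ)` given by the image of an object `(Γ, r)` of internal relations. -/
noncomputable def imagePredicate (X : IntRel ((sub R).comp G)) : Subobject (G'.obj (H.obj X.ctx)) :=
  predicate ((squareMap F H κ).obj X)

/-- The carrier of the image of an object of internal relations. -/
noncomputable def imageCarrier (X : IntRel ((sub R).comp G)) : R' := (imagePredicate F H κ X : R')

/-- The inclusion of the carrier of the image of an object of internal relations. -/
noncomputable def imageIncl (X : IntRel ((sub R).comp G)) :
    imageCarrier F H κ X ⟶ G'.obj (H.obj X.ctx) :=
  (imagePredicate F H κ X).arrow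

/-- The image predicate is the direct image of F(r) under a component of κ, and direct image along
an isomorphism is mere composition with it. This presents the image by the very mono with which the
canonical isomorphism has to be compatible. -/
theorem imagePredicate_eq (X : IntRel ((sub R).comp G)) :
    imagePredicate F H κ X = Subobject.mk (F.map (incl X) ≫ (squareIso F H κ X.ctx).hom) := by
  apply ext_factors
  intro A c
  refine (relImage_graph_iso_factors (squareIso F H κ X.ctx) (subMap F (predicate X)) c).trans ?_
  rw [subMap_factors, factors_mk_iff]
  refine exists_congr fun g => ?_
  rw [Iso.eq_comp_inv, Category.assoc]
  rfl

/-- The canonical isomorphism from the carrier of the image of an object to the image of its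
carrier. -/
noncomputable def carrierIso (X : IntRel ((sub R).comp G)) :
    imageCarrier F H κ X ≅ F.obj (carrier X) :=
  Subobject.isoOfEqMk _ _ (imagePredicate_eq F H κ X)

/-- The compatibility with the two inclusions that the statement demands of the natural isomorphism.
The mono on the left also makes it the cancellation rule for computing with `carrierIso`. -/
theorem carrierIso_hom_comp (X : IntRel ((sub R).comp G)) :
    (carrierIso F H κ X).hom ≫ F.map (incl X) ≫ (squareIso F H κ X.ctx).hom =
      imageIncl F H κ X :=
  Subobject.ofLEMk_comp (imagePredicate_eq F H κ X).le

/-- The subobject of `G' (H Γ₁ × H Γ₂)` underlying the image of an internal relation. -/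
noncomputable def imageUnderlying (θ : X ⟶ Y) : Subobject (G'.obj (H.obj X.ctx ⨯ H.obj Y.ctx)) :=
  underlying ((squareMap F H κ).map θ)

/-- The image of θ arises from F(θ) by transport along two isomorphisms, κ at Γ₁ × Γ₂ and the
comparison by which H preserves this product. Direct images along isomorphisms involve no covers, so
its elements come from F(θ) globally. -/
theorem imageUnderlying_factors (θ : X ⟶ Y) {A : R'}
    (c : A ⟶ G'.obj (H.obj X.ctx ⨯ H.obj Y.ctx)) :
    (imageUnderlying F H κ θ).Factors c ↔
      ∃ g : A ⟶ F.obj (underlying θ : R),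
        g ≫ F.map (underlying θ).arrow ≫ (squareIso F H κ _).hom =
          c ≫ G'.map (prodIso H X.ctx Y.ctx).hom := by
  have h : imageUnderlying F H κ θ =
      relImage (graph (G'.mapIso (prodIso H X.ctx Y.ctx)).symm.hom)
        (relImage (graph (squareIso F H κ (X.ctx ⨯ Y.ctx)).hom) (subMap F (underlying θ))) := by
    have h' : graph (G'.mapIso (prodIso H X.ctx Y.ctx)).symm.hom =
      mapFunctor G' (graph (prodIso H X.ctx Y.ctx).inv) := (mapFunctor_graph ..).symm
    rw [h']
    rfl
  rw [h, relImage_graph_iso_factors, relImage_graph_iso_factors, subMap_factors]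
  refine exists_congr fun g => ?_
  rw [Iso.eq_comp_inv, Category.assoc]
  rfl

/-- The relation between carriers obtained by restricting the image of an internal relation. -/
noncomputable def imageRestrict (θ : X ⟶ Y) : Reln (imageCarrier F H κ X) (imageCarrier F H κ Y) :=
  restrict ((squareMap F H κ).map θ)

/-- An element of the image of θ comes from an element g of F(θ). The generic element of θ has
components in the carriers, related by the restriction of θ; applying F and precomposing with g
gives the required pair. The converse is not needed for naturality, where both relations are graphs.
-/
theorem mapFunctor_restrict_holds (θ : X ⟶ Y) {A : R'} {a : A ⟶ imageCarrier F H κ X}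
    {b : A ⟶ imageCarrier F H κ Y} (h : (imageRestrict F H κ θ).Holds a b) :
    (mapFunctor F (restrict θ)).Holds (a ≫ (carrierIso F H κ X).hom)
      (b ≫ (carrierIso F H κ Y).hom) := by
  have h' : (imageUnderlying F H κ θ).Factors
      (pair (a ≫ imageIncl F H κ X) (b ≫ imageIncl F H κ Y)) := (holds_restrict _ a b).1 h
  obtain ⟨g, hg⟩ := (imageUnderlying_factors F H κ θ _).1 h'
  -- The components of the generic element of θ, namely its inclusion.
  obtain ⟨a', b', ha, hb⟩ := exists_components θ (arrow_factors (underlying θ))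
  have hθ : (restrict θ).Holds a' b' := by
    rw [holds_restrict, ← eq_pair ha hb]
    exact arrow_factors _
  -- The equation `hg` lives over the product context; naturality of κ projects it along any f, and
  -- it is used for the two projections.
  have hn : ∀ {Γ : D} (f : X.ctx ⨯ Y.ctx ⟶ Γ),
      g ≫ F.map ((underlying θ).arrow ≫ G.map f) ≫ (squareIso F H κ Γ).hom =
        pair (a ≫ imageIncl F H κ X) (b ≫ imageIncl F H κ Y) ≫
          G'.map ((prodIso H X.ctx Y.ctx).hom ≫ H.map f) := by
    intro Γ f
    rw [G'.map_comp, ← Category.assoc (pair _ _), ← hg, F.map_comp, Category.assoc,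
      squareIso_naturality]
    simp only [Category.assoc]
  have h1 : a ≫ (carrierIso F H κ X).hom = g ≫ F.map a' := by
    -- Elements of F(r) are compared after inclusion in G'(H Γ), where both sides become the first
    -- coordinate.
    rw [← cancel_mono (F.map (incl X) ≫ (squareIso F H κ X.ctx).hom), Category.assoc,
      carrierIso_hom_comp, Category.assoc, ← F.map_comp_assoc, ha, hn, prodIso_hom_fst, pair_fst]
  have h2 : b ≫ (carrierIso F H κ Y).hom = g ≫ F.map b' := by
    rw [← cancel_mono (F.map (incl Y) ≫ (squareIso F H κ Y.ctx).hom), Category.assoc,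
      carrierIso_hom_comp, Category.assoc, ← F.map_comp_assoc, hb, hn, prodIso_hom_snd, pair_snd]
  rw [h1, h2]
  exact (hθ.mapFunctor F).precomp g

/-- The functor on left adjoints between internal relations induced by a square of regular functors
that commutes up to isomorphism. -/
noncomputable abbrev squareFunctor :
    LAdj (IntRel ((sub R).comp G)) ⥤ LAdj (IntRel ((sub R').comp G')) :=
  LAdj.mapFunctor (squareMap F H κ) (fun h => IntRel.map_mono H (squareTrans F H κ) h)

/-- The graph of f' holds at the generic pair (id, f'). Transporting this pair into the graph of
`F.map f` gives the naturality square outright, so containment in one direction is enough. -/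
theorem carrierIso_naturality {X Y : LAdj (IntRel ((sub R).comp G))} (θ : X ⟶ Y)
    {f : carrier X.of ⟶ carrier Y.of} {f' : imageCarrier F H κ X.of ⟶ imageCarrier F H κ Y.of}
    (h : restrict θ.1 = graph f) (h' : imageRestrict F H κ θ.1 = graph f') :
    f' ≫ (carrierIso F H κ Y.of).hom = (carrierIso F H κ X.of).hom ≫ F.map f := by
  have hf : (imageRestrict F H κ θ.1).Holds (𝟙 _) f' := by
    rw [h', holds_graph, Category.id_comp]
  simpa only [h, mapFunctor_graph, holds_graph, Category.id_comp] using
    mapFunctor_restrict_holds F H κ θ.1 hf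

/-- The functors to the regular categories commute with the functors induced by a square of regular
functors. -/
noncomputable def toMorphismIso : squareFunctor F H κ ⋙ toMorphism G' ≅ toMorphism G ⋙ F :=
  NatIso.ofComponents (fun X => carrierIso F H κ X.of) (fun θ =>
    carrierIso_naturality F H κ θ (restrict_eq_graph θ)
      (restrict_eq_graph ((squareFunctor F H κ).map θ)))

end Naturality

end SubRel

end InternalRelationsOfSubobjects

/-! ### Embedding objects in interpretations of contexts, and the proposition. -/

/-- The context with a single variable of type r must have r in its support, so its interpretation
is r × Supp r rather than r. The map with components the identity and r → Supp r is split by the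
projection to the variable. -/
theorem exists_mono_to_quote {R : Type u} [Category.{v} R] [Regular R] (r : R) :
    ∃ (Γ : FRg R) (m : r ⟶ (FRg.quote R).obj Γ), Mono m := by
  let Γ : FRg R := ⟨1, {r}, Set.finite_singleton r, fun _ => r, fun _ => rfl⟩
  let m : r ⟶ (FRg.quote R).obj Γ := FRg.liftObj Γ (fun _ => 𝟙 r)
    -- An element s of the support {r} equals r only propositionally, hence the transport.
    (fun s => toSupp r ≫ eqToHom (congrArg Supp (Set.mem_singleton_iff.1 s.2).symm))
  have h : m ≫ FRg.varπ Γ 0 = 𝟙 r := FRg.liftObj_varπ ..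
  have : Mono (m ≫ FRg.varπ Γ 0) := by
    rw [h]
    infer_instance
  exact ⟨Γ, m, mono_of_mono m (FRg.varπ Γ 0)⟩

end GraphicalRegularLogic

theorem proposition8p3 :
    ∃ (ε : ∀ (R : Type u) [Category.{v} R] [Regular R], Syn (prd R) ⥤ R)
      (hε : ∀ (R : Type u) [Category.{v} R] [Regular R] (X : Syn (prd R)),
        (ε R).obj X = carrier X.of),
      (∀ (R : Type u) [Category.{v} R] [Regular R], (ε R).IsEquivalence) ∧
      (∀ (R : Type u) [Category.{v} R] [Regular R],
        (∀ X Y : IntRel (prd R).P,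
          Function.Bijective (fun θ : X ⟶ Y => restrict θ) ∧
          ∀ θ θ' : X ⟶ Y, restrict θ ≤ restrict θ' ↔ θ ≤ θ') ∧
        (∀ X : IntRel (prd R).P, restrict (𝟙 X) = Reln.graph (𝟙 (carrier X))) ∧
        (∀ (X Y Z : IntRel (prd R).P) (θ : X ⟶ Y) (θ' : Y ⟶ Z),
          restrict (θ ≫ θ') = (restrict θ).comp (restrict θ')) ∧
        (∀ (X Y : Syn (prd R)) (θ : X ⟶ Y),
          restrict θ.1 =
            Reln.graph (eqToHom (hε R X).symm ≫ (ε R).map θ ≫ eqToHom (hε R Y)))) ∧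
      (∀ (R R' : Type u) [Category.{v} R] [Regular R] [Category.{v} R'] [Regular R']
        (F : R ⥤ R') [IsRegularFunctor F],
        ∃ α : synMap (prdMap F) ⋙ ε R' ≅ ε R ⋙ F, ∀ X : Syn (prd R),
          α.hom.app X ≫ F.map (eqToHom (hε R X) ≫ incl X.of) ≫
              (FRg.quoteIso F).hom.app X.of.ctx =
            eqToHom (hε R' ((synMap (prdMap F)).obj X)) ≫
              incl ((synMap (prdMap F)).obj X).of) := by
  -- On objects the functor is the carrier by definition, so every `eqToHom` in the statement is
  -- definitionally an identity.
  refine ⟨fun R _ _ => SubRel.toMorphism (FRg.quote R), fun R _ _ X => rfl, ?_, ?_, ?_⟩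
  · exact fun R _ _ => SubRel.isEquivalence_toMorphism exists_mono_to_quote
  · intro R _ _
    refine ⟨fun X Y => ⟨⟨SubRel.restrict_injective, SubRel.restrict_surjective⟩,
      SubRel.restrict_le_iff⟩, SubRel.restrict_id, fun X Y Z => SubRel.restrict_comp,
      fun X Y θ => (SubRel.restrict_eq_graph θ).trans (congrArg Reln.graph ?_)⟩
    exact (Category.comp_id _).symm.trans (Category.id_comp _).symm
  · intro R R' _ _ _ _ F _
    refine ⟨SubRel.toMorphismIso F (FRg.map F.obj) (FRg.quoteIso F), fun X => ?_⟩
    have h := SubRel.carrierIso_hom_comp F (FRg.map F.obj) (FRg.quoteIso F) X.of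
    -- Identities are inserted to match the `eqToHom` terms of the goal.
    rw [← Category.id_comp (SubRel.incl X.of), ← Category.id_comp (SubRel.imageIncl ..)] at h
    exact h
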